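/- Let $A\in\mathbb R^{\ell\times n}$, $B\in\mathbb R^{\ell\times m}$, $b\in\mathbb R^{\ell}$, let $\mathcal X\subseteq\mathbb R^n$, $\mathcal Y\subseteq\mathbb R^m$ be polyhedra (solution sets of finitely many linear inequalities), and let $f:\mathbb R^n\to\mathbb R$, $g:\mathbb R^m\to\mathbb R$ be convex functions whose subdifferentials $\partial f$, $\partial g$ are piecewise linear multifunctions, i.e. each has a graph that is a union of finitely many polyhedra. Assume that the problem $$\min\{f(x)+g(y)\}\quad\text{s.t.}\quad Ax+By=b,\ x\in\mathcal X,\ y\in\mathcal Y$$ has an optimal solution. Let $\mathcal U^*$ be the set of its KKT points, i.e. of all $(x,y,\lambda)\in\mathcal X\times\mathcal Y\times\mathbb R^\ell$ with $Ax+By=b$ for which there are $\xi\in\partial f(x)$, $\zeta\in\partial g(y)$ with $-(\xi-A^\top\lambda)\in N_{\mathcal X}(x)$ and $-(\zeta-B^\top\lambda)\in N_{\mathcal Y}(y)$, where $N$ denotes the normal cone. Let $\alpha\in(0,2)$, $\beta>0$, let $G_1\in\mathbb R^{n\times n}$ and $G_2\in\mathbb R^{m\times m}$ be symmetric positive definite,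 and write $\|v\|_M=\sqrt{v^\top Mv}$. Let $u^k=(x^k,y^k,\lambda^k)$, $k\ge 0$, be a sequence generated, from an arbitrary starting point $u^0\in\mathbb R^n\times\mathbb R^m\times\mathbb R^\ell$, by the doubly proximal generalized ADMM (DP-GADMM) $$\begin{aligned} x^{k+1}&=\arg\min_{x\in\mathcal X}\Big\{f(x)-x^\top A^\top\lambda^k+\tfrac{\beta}{2}\|Ax+By^k-b\|^2+\tfrac12\|x-x^k\|_{G_1}^2\Big\},\\ y^{k+1}&=\arg\min_{y\in\mathcal Y}\Big\{g(y)-y^\top B^\top\lambda^k+\tfrac{\beta}{2}\|\alpha Ax^{k+1}+(1-\alpha)(b-By^k)+By-b\|^2+\tfrac12\|y-y^k\|_{G_2}^2\Big\},\\ \lambda^{k+1}&=\lambda^k-\beta\big(\alpha Ax^{k+1}+(1-\alpha)(b-By^k)+By^{k+1}-b\big). \end{aligned}$$ Put $$H_\alpha=\begin{pmatrix}G_1&0&0\\0&\frac{\beta}{\alpha}B^\top B+G_2&\frac{1-\alpha}{\alpha}B^\top\\0&\frac{1-\alpha}{\alpha}B&\frac{1}{\alpha\beta}I_\ell\end{pmatrix},\qquad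 \mathrm{dist}_{H_\alpha}(u,\mathcal U^*)=\min_{u^*\in\mathcal U^*}\|u-u^*\|_{H_\alpha}.$$ Then this minimum is attained for every $u\in\mathbb R^n\times\mathbb R^m\times\mathbb R^\ell$ (in particular $\mathcal U^*\neq\emptyset$), and there is $\tau'\in(0,1)$ such that for all $k\ge 0$ $$\mathrm{dist}^2_{H_\alpha}(u^{k+1},\mathcal U^*)\le\tau'\,\mathrm{dist}^2_{H_\alpha}(u^k,\mathcal U^*).$$ -/

import Mathlib

open Matrix

noncomputable section

namespace DPGADMM

/-- The Euclidean norm of a coordinate vector. -/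
def euclNorm {ι : Type*} [Fintype ι] (v : ι → ℝ) : ℝ := ‖WithLp.toLp 2 v‖

/-- The norm `‖v‖_M = √(vᵀ M v)` attached to a positive definite matrix `M`. -/
def matNorm {ι : Type*} [Fintype ι] (M : Matrix ι ι ℝ) (v : ι → ℝ) : ℝ :=
  Real.sqrt (v ⬝ᵥ (M *ᵥ v))

/-- The distance `dist_M(v, S)` from `v` to `S` in the norm `‖·‖_M`. -/
def matDist {ι : Type*} [Fintype ι] (M : Matrix ι ι ℝ) (v : ι → ℝ) (S : Set (ι → ℝ)) : ℝ :=
  sInf ((fun w => matNorm M (v - w)) '' S)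

/-- A polyhedron: the solution set of finitely many (possibly zero) linear inequalities. -/
def IsPolyhedron {E : Type*} [AddCommGroup E] [Module ℝ E] (S : Set E) : Prop :=
  ∃ (N : ℕ) (a : Fin N → (E →ₗ[ℝ] ℝ)) (c : Fin N → ℝ), S = {z | ∀ i, a i z ≤ c i}

/-- A multifunction is piecewise linear if its graph is a union of finitely many polyhedra. -/
def IsPiecewiseLinear {E F : Type*} [AddCommGroup E] [Module ℝ E] [AddCommGroup F] [Module ℝ F]
    (T : E → Set F) : Prop :=
  ∃ (N : ℕ) (P : Fin N → Set (E × F)), (∀ i, IsPolyhedron (P i)) ∧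
    {p : E × F | p.2 ∈ T p.1} = ⋃ i, P i

/-- The subdifferential of convex analysis. -/
def subdiff {n : ℕ} (f : (Fin n → ℝ) → ℝ) (x : Fin n → ℝ) : Set (Fin n → ℝ) :=
  {ξ | ∀ z, f x + ξ ⬝ᵥ (z - x) ≤ f z}

/-- The normal cone of `S` at `z` (empty if `z ∉ S`). -/
def normalCone {n : ℕ} (S : Set (Fin n → ℝ)) (z : Fin n → ℝ) : Set (Fin n → ℝ) :=
  {v | z ∈ S ∧ ∀ w ∈ S, v ⬝ᵥ (w - z) ≤ 0}

/-- `z` is a minimizer of `φ` over `S`. -/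
def IsArgmin {E : Type*} (φ : E → ℝ) (S : Set E) (z : E) : Prop :=
  z ∈ S ∧ ∀ w ∈ S, φ z ≤ φ w

/-- `(x, y)` is an optimal solution of
`min f(x) + g(y)` subject to `A x + B y = b`, `x ∈ X`, `y ∈ Y`. -/
def IsOptimal {n m l : ℕ} (A : Matrix (Fin l) (Fin n) ℝ) (B : Matrix (Fin l) (Fin m) ℝ)
    (b : Fin l → ℝ) (X : Set (Fin n → ℝ)) (Y : Set (Fin m → ℝ))
    (f : (Fin n → ℝ) → ℝ) (g : (Fin m → ℝ) → ℝ) (x : Fin n → ℝ) (y : Fin m → ℝ) : Prop :=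
  IsArgmin (fun p : (Fin n → ℝ) × (Fin m → ℝ) => f p.1 + g p.2)
    {p | p.1 ∈ X ∧ p.2 ∈ Y ∧ A *ᵥ p.1 + B *ᵥ p.2 = b} (x, y)

/-- The column vector `(x, y, lam)`. -/
def stack {n m l : ℕ} (x : Fin n → ℝ) (y : Fin m → ℝ) (lam : Fin l → ℝ) :
    Fin n ⊕ Fin m ⊕ Fin l → ℝ :=
  Sum.elim x (Sum.elim y lam)

/-- The set `𝒰*` of KKT points of the problem. Membership of `x` in `X` and of `y` in `Y` is
contained in the normal cone conditions. -/
def KKTSet {n m l : ℕ} (A : Matrix (Fin l) (Fin n) ℝ) (B : Matrix (Fin l) (Fin m) ℝ)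
    (b : Fin l → ℝ) (X : Set (Fin n → ℝ)) (Y : Set (Fin m → ℝ))
    (f : (Fin n → ℝ) → ℝ) (g : (Fin m → ℝ) → ℝ) : Set (Fin n ⊕ Fin m ⊕ Fin l → ℝ) :=
  {u | ∃ x y lam, u = stack x y lam ∧
    (∃ ξ ∈ subdiff f x, -(ξ - Aᵀ *ᵥ lam) ∈ normalCone X x) ∧
    (∃ ζ ∈ subdiff g y, -(ζ - Bᵀ *ᵥ lam) ∈ normalCone Y y) ∧
    A *ᵥ x + B *ᵥ y - b = 0}

/-- The sequence `(x k, y k, lam k)` is generated by the doubly proximal generalized ADMM with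
relaxation factor `α`, penalty parameter `β` and proximal matrices `G₁`, `G₂`, from an arbitrary
starting point. -/
structure IsDPGADMM {n m l : ℕ} (A : Matrix (Fin l) (Fin n) ℝ) (B : Matrix (Fin l) (Fin m) ℝ)
    (b : Fin l → ℝ) (X : Set (Fin n → ℝ)) (Y : Set (Fin m → ℝ))
    (f : (Fin n → ℝ) → ℝ) (g : (Fin m → ℝ) → ℝ) (α β : ℝ)
    (G₁ : Matrix (Fin n) (Fin n) ℝ) (G₂ : Matrix (Fin m) (Fin m) ℝ)
    (x : ℕ → Fin n → ℝ) (y : ℕ → Fin m → ℝ) (lam : ℕ → Fin l → ℝ) : Prop where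
  x_step : ∀ k, IsArgmin
    (fun z => f z - z ⬝ᵥ (Aᵀ *ᵥ lam k) + β / 2 * euclNorm (A *ᵥ z + B *ᵥ y k - b) ^ 2
      + 1 / 2 * matNorm G₁ (z - x k) ^ 2) X (x (k + 1))
  y_step : ∀ k, IsArgmin
    (fun z => g z - z ⬝ᵥ (Bᵀ *ᵥ lam k)
      + β / 2 * euclNorm (α • (A *ᵥ x (k + 1)) + (1 - α) • (b - B *ᵥ y k) + B *ᵥ z - b) ^ 2
      + 1 / 2 * matNorm G₂ (z - y k) ^ 2) Y (y (k + 1))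
  lam_step : ∀ k, lam (k + 1) = lam k -
    β • (α • (A *ᵥ x (k + 1)) + (1 - α) • (b - B *ᵥ y k) + B *ᵥ y (k + 1) - b)

/-- The block matrix `H_α` with rows `(G₁, 0, 0)`, `(0, (β/α) BᵀB + G₂, ((1-α)/α) Bᵀ)` and
`(0, ((1-α)/α) B, (1/(αβ)) I)`. -/
def Hmat {n m l : ℕ} (B : Matrix (Fin l) (Fin m) ℝ) (α β : ℝ)
    (G₁ : Matrix (Fin n) (Fin n) ℝ) (G₂ : Matrix (Fin m) (Fin m) ℝ) :
    Matrix (Fin n ⊕ Fin m ⊕ Fin l) (Fin n ⊕ Fin m ⊕ Fin l) ℝ :=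
  fromBlocks G₁ 0 0
    (fromBlocks ((β / α) • (Bᵀ * B) + G₂) (((1 - α) / α) • Bᵀ)
      (((1 - α) / α) • B) ((1 / (α * β)) • (1 : Matrix (Fin l) (Fin l) ℝ)))

end DPGADMM

end

/-!
Write `u = (x, y, λ)` for an iterate, `u'` for the next one, and `d = u - u'`.

Minimizing a finite convex function over a convex set is equivalent to a subgradient inclusion
(`isArgmin_sub_iff`, by separation), so `u` is a KKT point iff `x` and `y` minimize `f - ⟨Aᵀλ, ·⟩`
over `X` and `g - ⟨Bᵀλ, ·⟩` over `Y`, and the linear constraint holds (`stack_mem_KKTSet_iff`). Hence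
the set of KKT points is closed; it is nonempty by Farkas' lemma (`KKTSet_nonempty`). As `H_α` is
positive definite (`quadForm_Hmat_pos`), distances to this set are attained.

The linear rate combines two estimates.

* *Contraction* (`IsDPGADMM.contraction`). Monotonicity of `∂f + N_X` and `∂g + N_Y`, applied to
  the optimality conditions of the two subproblems and to the KKT conditions, gives
  `‖u' - u*‖² + Δ ≤ ‖u - u*‖²` in the norm of `H_α`, where
  `Δ = ‖dx‖²_{G₁} + ‖dy‖²_{G₂} + (2 - α) / (α² β) ‖dλ + β B dy‖²` is a definite quadratic form of
  `dx`, `dy` and `dλ + β B dy`.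
* *Error bound* (`KKTSet_error_bound`). The graphs of `∂f + N_X` and `∂g + N_Y` are finite unions
  of linear images of polyhedra (`exists_polyhedral_lift`), so Hoffman's error bound on each piece
  (`IsPolyhedron.error_bound`) shows that the distance from `u'` to the KKT points is at most a
  multiple of the KKT residual at `u'`, unless the residual exceeds a fixed positive number. In the
  latter case the distance, bounded by its initial value, is again at most a multiple of the
  residual. The residual at `u'` is a linear function of `dx`, `dy` and `dλ + β B dy`
  (`exists_residual_bound`), so its square is at most a multiple of `Δ`.

Together `dist²(u') ≤ M Δ ≤ M (dist²(u) - dist²(u'))`, and `τ = M / (1 + M)` is a rate.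
-/

open Matrix

noncomputable section

namespace DPGADMM

open Filter Topology

/-! ### Systems of finitely many linear inequalities -/

/-- **Farkas' lemma**, over an arbitrary real vector space. -/
theorem farkas {E ι : Type*} [AddCommGroup E] [Module ℝ E] (s : Finset ι) :
    ∀ (a : ι → E →ₗ[ℝ] ℝ) (φ : E →ₗ[ℝ] ℝ), (∀ d, (∀ i ∈ s, a i d ≤ 0) → φ d ≤ 0) →
      ∃ μ : ι → ℝ, (∀ i, 0 ≤ μ i) ∧ φ = ∑ i ∈ s, μ i • a i := by
  classical
  induction s using Finset.induction_on with
  | empty =>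
    intro a φ h
    refine ⟨0, fun _ => le_rfl, ?_⟩
    ext d
    have h1 := h d (by simp)
    have h2 := h (-d) (by simp)
    rw [map_neg] at h2
    simp only [Finset.sum_empty, LinearMap.zero_apply]
    linarith
  | insert j s hj ih =>
    intro a φ h
    by_cases hs : ∀ d, (∀ i ∈ s, a i d ≤ 0) → φ d ≤ 0
    · obtain ⟨μ, hμ, hφ⟩ := ih a φ hs
      refine ⟨Function.update μ j 0, fun i => ?_, ?_⟩
      · rcases eq_or_ne i j with rfl | hij
        · simp
        · simpa [hij] using hμ i
      · rw [Finset.sum_insert hj, hφ]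
        simp only [Function.update_self, zero_smul, zero_add]
        refine Finset.sum_congr rfl fun i hi => ?_
        rw [Function.update_of_ne (ne_of_mem_of_not_mem hi hj)]
    · push Not at hs
      obtain ⟨d₀, hd₀, hφ₀⟩ := hs
      have hj₀ : 0 < a j d₀ := by
        by_contra! hcon
        exact absurd (h d₀ (by simpa [hcon] using hd₀)) (not_le.2 hφ₀)
      -- Projecting along `d₀` onto the kernel of `a j` removes the constraint `a j ≤ 0`.
      obtain ⟨μ, hμ, hφ⟩ := ih (fun i => a i - (a i d₀ / a j d₀) • a j)
        (φ - (φ d₀ / a j d₀) • a j) (by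
          intro d hd
          have key := h (d - (a j d / a j d₀) • d₀) (by
            intro i hi
            rcases Finset.mem_insert.1 hi with rfl | hi
            · simp [div_mul_cancel₀ _ hj₀.ne']
            · have := hd i hi
              simp only [LinearMap.sub_apply, LinearMap.smul_apply, smul_eq_mul, map_sub,
                map_smul] at this ⊢
              calc _ = _ := by ring
                _ ≤ 0 := this)
          simp only [LinearMap.sub_apply, LinearMap.smul_apply, smul_eq_mul, map_sub,
            map_smul] at key ⊢
          calc _ = _ := by ring
            _ ≤ 0 := key)
      refine ⟨Function.update μ j (φ d₀ / a j d₀ - ∑ i ∈ s, μ i * (a i d₀ / a j d₀)),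
        fun i => ?_, ?_⟩
      · rcases eq_or_ne i j with rfl | hij
        · rw [Function.update_self]
          have h1 : ∑ k ∈ s, μ k * (a k d₀ / a i d₀) ≤ 0 := Finset.sum_nonpos fun k hk =>
            mul_nonpos_of_nonneg_of_nonpos (hμ k)
              (div_nonpos_of_nonpos_of_nonneg (hd₀ k hk) hj₀.le)
          have h2 := div_pos hφ₀ hj₀
          linarith
        · simpa [hij] using hμ i
      · rw [Finset.sum_insert hj, Function.update_self]
        have hsum : ∑ i ∈ s, Function.update μ j
            (φ d₀ / a j d₀ - ∑ i ∈ s, μ i * (a i d₀ / a j d₀)) i • a i = ∑ i ∈ s, μ i • a i :=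
          Finset.sum_congr rfl fun i hi => by
            rw [Function.update_of_ne (ne_of_mem_of_not_mem hi hj)]
        rw [hsum]
        ext d
        have hd := LinearMap.congr_fun hφ d
        simp only [LinearMap.sub_apply, LinearMap.smul_apply, LinearMap.add_apply,
          LinearMap.sum_apply, smul_eq_mul, mul_sub, Finset.sum_sub_distrib] at hd ⊢
        rw [sub_mul, Finset.sum_mul]
        simp only [mul_assoc]
        linarith

/-- A direction along which no active constraint increases can be followed for a positive time. -/
theorem exists_feasible_step {E ι : Type*} [AddCommGroup E] [Module ℝ E] [Finite ι]
    {a : ι → E →ₗ[ℝ] ℝ} {c : ι → ℝ} {z d : E} (hz : ∀ i, a i z ≤ c i)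
    (hd : ∀ i, a i z = c i → a i d ≤ 0) : ∃ t : ℝ, 0 < t ∧ ∀ i, a i (z + t • d) ≤ c i := by
  have h : ∀ i, ∀ᶠ t : ℝ in 𝓝[>] 0, a i (z + t • d) ≤ c i := by
    intro i
    rcases (hz i).eq_or_lt with hi | hi
    · filter_upwards [self_mem_nhdsWithin] with t ht
      have := mul_nonpos_of_nonneg_of_nonpos (le_of_lt ht) (hd i hi)
      rw [map_add, map_smul, smul_eq_mul]
      linarith
    · have hc : Tendsto (fun t : ℝ => a i z + t * a i d) (𝓝[>] 0) (𝓝 (a i z + 0 * a i d)) :=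
        ((continuous_const.add (continuous_id.mul continuous_const)).tendsto 0).mono_left
          nhdsWithin_le_nhds
      rw [zero_mul, add_zero] at hc
      filter_upwards [hc.eventually_lt_const hi] with t ht
      simpa using ht.le
  obtain ⟨t, ht, ht0⟩ := ((eventually_all.2 h).and self_mem_nhdsWithin).exists
  exact ⟨t, ht0, ht⟩

/-- The normal cone of a polyhedron is generated by the normals of the active constraints. -/
theorem exists_multipliers {E ι : Type*} [AddCommGroup E] [Module ℝ E] [Fintype ι]
    {a : ι → E →ₗ[ℝ] ℝ} {c : ι → ℝ} {z : E} (hz : ∀ i, a i z ≤ c i) {φ : E →ₗ[ℝ] ℝ}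
    (hφ : ∀ w, (∀ i, a i w ≤ c i) → φ (w - z) ≤ 0) :
    ∃ μ : ι → ℝ, (∀ i, 0 ≤ μ i) ∧ (∀ i, a i z ≠ c i → μ i = 0) ∧ φ = ∑ i, μ i • a i := by
  classical
  obtain ⟨μ, hμ, h⟩ := farkas (Finset.univ.filter fun i => a i z = c i) a φ (by
    intro d hd
    obtain ⟨t, ht, hf⟩ := exists_feasible_step (d := d) hz (by simpa using hd)
    have := hφ _ hf
    rw [add_sub_cancel_left, map_smul, smul_eq_mul] at this
    exact nonpos_of_mul_nonpos_right this ht)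
  refine ⟨fun i => if a i z = c i then μ i else 0, fun i => ?_, fun i hi => by simp [hi], ?_⟩
  · dsimp only
    split_ifs
    exacts [hμ i, le_rfl]
  · rw [h, Finset.sum_filter]
    refine Finset.sum_congr rfl fun i _ => ?_
    by_cases hi : a i z = c i <;> simp [hi]

/-- An infeasible system is violated by a fixed positive amount at every point. -/
theorem infeasible_bound {E ι : Type*} [AddCommGroup E] [Module ℝ E] [Fintype ι]
    (a : ι → E →ₗ[ℝ] ℝ) (c : ι → ℝ) (h : ¬ ∃ z, ∀ i, a i z ≤ c i) :
    ∃ C : ℝ, 0 ≤ C ∧ ∀ z, 1 ≤ C * ∑ i, max (a i z - c i) 0 := by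
  -- By homogenization, `t ≤ 0` follows from the inequalities `a i d ≤ t * c i`.
  obtain ⟨μ, hμ, hsum⟩ := farkas (Finset.univ : Finset (Option ι))
    (fun o => o.elim (-(LinearMap.snd ℝ E ℝ)) fun i =>
      (a i) ∘ₗ LinearMap.fst ℝ E ℝ - c i • LinearMap.snd ℝ E ℝ) (LinearMap.snd ℝ E ℝ) (by
    rintro ⟨d, t⟩ hd
    by_contra! ht
    simp only [LinearMap.snd_apply] at ht
    refine h ⟨t⁻¹ • d, fun i => ?_⟩
    have := hd (some i) (Finset.mem_univ _)
    simp only [Option.elim_some, LinearMap.sub_apply, LinearMap.comp_apply, LinearMap.fst_apply,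
      LinearMap.smul_apply, LinearMap.snd_apply, smul_eq_mul] at this
    rw [map_smul, smul_eq_mul, inv_mul_le_iff₀ ht]
    linarith)
  rw [Fintype.sum_option] at hsum
  refine ⟨∑ i, μ (some i), Finset.sum_nonneg fun i _ => hμ _, fun z => ?_⟩
  have h1 := LinearMap.congr_fun hsum (z, 1)
  simp only [Option.elim_some, Option.elim_none, LinearMap.add_apply, LinearMap.smul_apply,
    LinearMap.neg_apply, LinearMap.snd_apply, LinearMap.sum_apply, LinearMap.sub_apply,
    LinearMap.comp_apply, LinearMap.fst_apply, smul_eq_mul, mul_one] at h1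
  have h2 : ∑ i, μ (some i) * (a i z - c i) ≤
      ∑ i, μ (some i) * ∑ j, max (a j z - c j) 0 := by
    refine Finset.sum_le_sum fun i _ => mul_le_mul_of_nonneg_left ?_ (hμ _)
    exact (le_max_left _ _).trans (Finset.single_le_sum
      (f := fun j => max (a j z - c j) 0) (fun j _ => le_max_right _ _) (Finset.mem_univ i))
  rw [← Finset.sum_mul] at h2
  have h3 := hμ none
  linarith

/-! ### Hoffman's error bound -/

/-- On the polar of the cone `{d | a i d ≤ 0 for i ∈ J}`, the norm is controlled by the positive
parts of the `a i`, because a point of the polar that lies in the cone is orthogonal to itself. -/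
theorem polar_bound {E ι : Type*} [NormedAddCommGroup E] [InnerProductSpace ℝ E]
    [FiniteDimensional ℝ E] (a : ι → E →ₗ[ℝ] ℝ) (J : Finset ι) :
    ∃ C : ℝ, 0 ≤ C ∧ ∀ p : E, (∀ d, (∀ i ∈ J, a i d ≤ 0) → inner ℝ p d ≤ 0) →
      ‖p‖ ≤ C * ∑ i ∈ J, max (a i p) 0 := by
  have : ProperSpace E := FiniteDimensional.proper ℝ E
  let K : Set E := {p | ∀ d, (∀ i ∈ J, a i d ≤ 0) → inner ℝ p d ≤ 0}
  have hK : IsClosed K := by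
    have : K = ⋂ d, ⋂ (_ : ∀ i ∈ J, a i d ≤ 0), {p | inner ℝ p d ≤ 0} := by
      ext p; simp [K]
    rw [this]
    exact isClosed_iInter fun d => isClosed_iInter fun _ =>
      isClosed_le (continuous_id.inner continuous_const) continuous_const
  have hcont : Continuous fun p : E => ∑ i ∈ J, max (a i p) 0 :=
    continuous_finsetSum _ fun i _ =>
      (a i).continuous_of_finiteDimensional.max continuous_const
  have hcomp : IsCompact (K ∩ Metric.sphere 0 1) := (isCompact_sphere 0 1).inter_left hK
  rcases (K ∩ Metric.sphere 0 1).eq_empty_or_nonempty with hemp | hne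
  · refine ⟨0, le_rfl, fun p hp => ?_⟩
    by_contra! hcon
    rw [zero_mul] at hcon
    have : (‖p‖⁻¹ • p) ∈ K ∩ Metric.sphere 0 1 := by
      refine ⟨fun d hd => ?_, ?_⟩
      · rw [real_inner_smul_left]
        exact mul_nonpos_of_nonneg_of_nonpos (inv_nonneg.2 hcon.le) (hp d hd)
      · rw [mem_sphere_zero_iff_norm, norm_smul, norm_inv, norm_norm, inv_mul_cancel₀ hcon.ne']
    rw [hemp] at this
    exact this
  · obtain ⟨p₀, ⟨hp₀K, hp₀⟩, hmin⟩ := hcomp.exists_isMinOn hne hcont.continuousOn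
    rw [mem_sphere_zero_iff_norm] at hp₀
    set δ := ∑ i ∈ J, max (a i p₀) 0 with hδ
    have hδ0 : 0 < δ := by
      refine lt_of_le_of_ne (Finset.sum_nonneg fun i _ => le_max_right _ _) fun h0 => ?_
      have h1 := (Finset.sum_eq_zero_iff_of_nonneg fun i _ => le_max_right _ _).1 (hδ ▸ h0.symm)
      have h2 := hp₀K p₀ fun i hi => max_eq_right_iff.1 (h1 i hi)
      rw [real_inner_self_eq_norm_sq, hp₀] at h2
      norm_num at h2
    refine ⟨δ⁻¹, inv_nonneg.2 hδ0.le, fun p hp => ?_⟩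
    rcases eq_or_ne p 0 with rfl | hp0
    · rw [norm_zero]
      exact mul_nonneg (inv_nonneg.2 hδ0.le) (Finset.sum_nonneg fun i _ => le_max_right _ _)
    have hn : 0 < ‖p‖ := norm_pos_iff.2 hp0
    have hmem : (‖p‖⁻¹ • p) ∈ K ∩ Metric.sphere 0 1 := by
      refine ⟨fun d hd => ?_, ?_⟩
      · rw [real_inner_smul_left]
        exact mul_nonpos_of_nonneg_of_nonpos (inv_nonneg.2 hn.le) (hp d hd)
      · rw [mem_sphere_zero_iff_norm, norm_smul, norm_inv, norm_norm, inv_mul_cancel₀ hn.ne']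
    have h1 : δ ≤ ‖p‖⁻¹ * ∑ i ∈ J, max (a i p) 0 := by
      refine (hmin hmem).trans_eq ?_
      simp only [Finset.mul_sum, map_smul, smul_eq_mul]
      refine Finset.sum_congr rfl fun i _ => ?_
      rw [mul_max_of_nonneg _ _ (inv_nonneg.2 hn.le), mul_zero]
    rw [le_inv_mul_iff₀ hδ0]
    rw [le_inv_mul_iff₀ hn] at h1
    linarith

/-- **Hoffman's error bound** in a Euclidean space: `z - z'`, for the projection `z'` of `z`, lies
in the polar of the tangent cone at `z'`, which depends only on the set of active constraints. -/
theorem hoffman_inner {E ι : Type*} [NormedAddCommGroup E] [InnerProductSpace ℝ E]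
    [FiniteDimensional ℝ E] [Fintype ι] (a : ι → E →ₗ[ℝ] ℝ) (c : ι → ℝ)
    (hne : {z | ∀ i, a i z ≤ c i}.Nonempty) :
    ∃ C : ℝ, 0 ≤ C ∧ ∀ z, ∃ z', (∀ i, a i z' ≤ c i) ∧
      ‖z - z'‖ ≤ C * ∑ i, max (a i z - c i) 0 := by
  classical
  choose C hC0 hC using polar_bound a
  refine ⟨∑ J, C J, Finset.sum_nonneg fun J _ => hC0 J, fun z => ?_⟩
  let S : Set E := {w | ∀ i, a i w ≤ c i}
  have hSc : IsClosed S := by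
    have : S = ⋂ i, {w | a i w ≤ c i} := by ext; simp [S]
    rw [this]
    exact isClosed_iInter fun i =>
      isClosed_le (a i).continuous_of_finiteDimensional continuous_const
  have hSconv : Convex ℝ S := by
    have : S = ⋂ i, {w | a i w ≤ c i} := by ext; simp [S]
    rw [this]
    exact convex_iInter fun i => convex_halfSpace_le (a i).isLinear (c i)
  have hcompl : IsComplete S := hSc.isComplete
  obtain ⟨z', hz'S, hz'⟩ := exists_norm_eq_iInf_of_complete_convex (K := S) hne hcompl hSconv z
  rw [norm_eq_iInf_iff_real_inner_le_zero hSconv hz'S] at hz'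
  refine ⟨z', hz'S, ?_⟩
  set J : Finset ι := Finset.univ.filter fun i => a i z' = c i with hJ
  have h1 : ‖z - z'‖ ≤ C J * ∑ i ∈ J, max (a i (z - z')) 0 := by
    refine hC J _ fun d hd => ?_
    obtain ⟨t, ht, hf⟩ := exists_feasible_step (d := d) hz'S (by simpa [hJ] using hd)
    have := hz' _ hf
    rw [add_sub_cancel_left, real_inner_smul_right] at this
    exact nonpos_of_mul_nonpos_right this ht
  have h2 : ∑ i ∈ J, max (a i (z - z')) 0 = ∑ i ∈ J, max (a i z - c i) 0 :=
    Finset.sum_congr rfl fun i hi => by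
      rw [map_sub, (Finset.mem_filter.1 hi).2]
  rw [h2] at h1
  refine h1.trans (mul_le_mul ?_ ?_ (Finset.sum_nonneg fun i _ => le_max_right _ _)
    (Finset.sum_nonneg fun J _ => hC0 J))
  · exact Finset.single_le_sum (f := C) (fun J _ => hC0 J) (Finset.mem_univ J)
  · exact Finset.sum_le_sum_of_subset_of_nonneg (Finset.subset_univ J)
      fun i _ _ => le_max_right _ _

/-- Hoffman's error bound, with an alternative that covers infeasible systems. -/
theorem hoffman {E ι : Type*} [NormedAddCommGroup E] [NormedSpace ℝ E]
    [FiniteDimensional ℝ E] [Fintype ι] (a : ι → E →ₗ[ℝ] ℝ) (c : ι → ℝ) :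
    ∃ C : ℝ, 0 ≤ C ∧ ∀ z, (∃ z', (∀ i, a i z' ≤ c i) ∧
      ‖z - z'‖ ≤ C * ∑ i, max (a i z - c i) 0) ∨ 1 ≤ C * ∑ i, max (a i z - c i) 0 := by
  by_cases hne : ∃ z, ∀ i, a i z ≤ c i
  · let e := toEuclidean (E := E)
    obtain ⟨C, hC0, hC⟩ := hoffman_inner (fun i => a i ∘ₗ e.symm.toLinearMap) c
      (by obtain ⟨z, hz⟩ := hne; exact ⟨e z, by simpa using hz⟩)
    refine ⟨‖(e.symm : EuclideanSpace ℝ (Fin (Module.finrank ℝ E)) →L[ℝ] E)‖ * C, by positivity, fun z => Or.inl ?_⟩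
    obtain ⟨w, hw, hzw⟩ := hC (e z)
    refine ⟨e.symm w, hw, ?_⟩
    have h1 := (e.symm : EuclideanSpace ℝ (Fin (Module.finrank ℝ E)) →L[ℝ] E).le_opNorm (e z - w)
    simp only [ContinuousLinearEquiv.coe_coe, map_sub,
      ContinuousLinearEquiv.symm_apply_apply] at h1
    refine h1.trans ?_
    rw [mul_assoc]
    refine mul_le_mul_of_nonneg_left (hzw.trans_eq ?_) (norm_nonneg _)
    simp
  · obtain ⟨C, hC0, hC⟩ := infeasible_bound a c hne
    exact ⟨C, hC0, fun z => Or.inr (hC z)⟩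

/-- On a polyhedron `P`, the distance to the points of `P` that solve `L z = r` is controlled by
the residual `‖L z - r‖`; if there are no such points, the residual is bounded below. -/
theorem IsPolyhedron.error_bound {E F : Type*} [NormedAddCommGroup E] [NormedSpace ℝ E]
    [FiniteDimensional ℝ E] [NormedAddCommGroup F] [NormedSpace ℝ F] [FiniteDimensional ℝ F]
    {P : Set E} (hP : IsPolyhedron P) (L : E →ₗ[ℝ] F) (r : F) :
    ∃ C : ℝ, 0 ≤ C ∧ ∀ z ∈ P, (∃ z' ∈ P, L z' = r ∧ ‖z - z'‖ ≤ C * ‖L z - r‖) ∨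
      1 ≤ C * ‖L z - r‖ := by
  obtain ⟨N, a, c, rfl⟩ := hP
  let b := Module.finBasis ℝ F
  obtain ⟨C, hC0, hC⟩ := hoffman
    (Sum.elim a (Sum.elim (fun j => b.coord j ∘ₗ L) fun j => -(b.coord j ∘ₗ L)))
    (Sum.elim c (Sum.elim (fun j => b.coord j r) fun j => -(b.coord j r)))
  let D : ℝ := ∑ j, ‖(b.coord j).toContinuousLinearMap‖
  have hD : 0 ≤ D := Finset.sum_nonneg fun j _ => norm_nonneg _
  have habs : ∀ v : F, ∑ j, |b.coord j v| ≤ D * ‖v‖ := fun v => by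
    rw [Finset.sum_mul]
    exact Finset.sum_le_sum fun j _ => (b.coord j).toContinuousLinearMap.le_opNorm v
  refine ⟨C * D, mul_nonneg hC0 hD, fun z hz => ?_⟩
  have hsum : C * ∑ i, max ((Sum.elim a (Sum.elim (fun j => b.coord j ∘ₗ L)
      fun j => -(b.coord j ∘ₗ L))) i z -
      (Sum.elim c (Sum.elim (fun j => b.coord j r) fun j => -(b.coord j r))) i) 0 ≤
      C * D * ‖L z - r‖ := by
    rw [mul_assoc]
    refine mul_le_mul_of_nonneg_left (le_trans (le_of_eq ?_) (habs _)) hC0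
    simp only [Fintype.sum_sum_type, Sum.elim_inl, Sum.elim_inr]
    rw [Finset.sum_eq_zero fun i _ => max_eq_right (sub_nonpos.2 (hz i)), zero_add,
      ← Finset.sum_add_distrib]
    refine Finset.sum_congr rfl fun j _ => ?_
    simp only [LinearMap.neg_apply, LinearMap.comp_apply, map_sub]
    generalize b.coord j (L z) = p
    generalize b.coord j r = q
    rcases le_total p q with h | h
    · rw [max_eq_right (by linarith), max_eq_left (by linarith), abs_of_nonpos (by linarith)]
      ring
    · rw [max_eq_left (by linarith), max_eq_right (by linarith), abs_of_nonneg (by linarith)]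
      ring
  rcases hC z with ⟨z', hz', hle⟩ | h1
  · refine Or.inl ⟨z', fun i => hz' (Sum.inl i), ?_, hle.trans hsum⟩
    refine b.ext_elem fun j => le_antisymm ?_ ?_
    · exact hz' (Sum.inr (Sum.inl j))
    · have := hz' (Sum.inr (Sum.inr j))
      simpa using this
  · exact Or.inr (h1.trans hsum)

/-! ### Polyhedra -/

theorem IsPolyhedron.of_finite {E ι : Type*} [AddCommGroup E] [Module ℝ E] [Finite ι]
    (a : ι → E →ₗ[ℝ] ℝ) (c : ι → ℝ) : IsPolyhedron {z | ∀ i, a i z ≤ c i} := by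
  obtain ⟨N, ⟨e⟩⟩ := Finite.exists_equiv_fin ι
  refine ⟨N, a ∘ e.symm, c ∘ e.symm, ?_⟩
  ext z
  exact e.symm.forall_congr_right.symm

theorem IsPolyhedron.inter {E : Type*} [AddCommGroup E] [Module ℝ E] {S T : Set E}
    (hS : IsPolyhedron S) (hT : IsPolyhedron T) : IsPolyhedron (S ∩ T) := by
  obtain ⟨N, a, c, rfl⟩ := hS
  obtain ⟨M, a', c', rfl⟩ := hT
  convert IsPolyhedron.of_finite (Sum.elim a a') (Sum.elim c c') using 1
  ext z
  simp

theorem IsPolyhedron.preimage {E F : Type*} [AddCommGroup E] [Module ℝ E] [AddCommGroup F]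
    [Module ℝ F] {S : Set F} (hS : IsPolyhedron S) (L : E →ₗ[ℝ] F) :
    IsPolyhedron (L ⁻¹' S) := by
  obtain ⟨N, a, c, rfl⟩ := hS
  exact ⟨N, fun i => a i ∘ₗ L, c, rfl⟩

theorem IsPolyhedron.convex {E : Type*} [AddCommGroup E] [Module ℝ E] {S : Set E}
    (hS : IsPolyhedron S) : Convex ℝ S := by
  obtain ⟨N, a, c, rfl⟩ := hS
  rw [Set.ofPred_forall]
  exact convex_iInter fun i => convex_halfSpace_le (a i).isLinear (c i)

theorem IsPolyhedron.isClosed {E : Type*} [NormedAddCommGroup E] [NormedSpace ℝ E]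
    [FiniteDimensional ℝ E] {S : Set E} (hS : IsPolyhedron S) : IsClosed S := by
  obtain ⟨N, a, c, rfl⟩ := hS
  rw [Set.ofPred_forall]
  exact isClosed_iInter fun i =>
    isClosed_le (a i).continuous_of_finiteDimensional continuous_const

/-- Lagrange multipliers for linear equality constraints over a polyhedron. -/
theorem IsPolyhedron.exists_equality_multiplier {E κ : Type*} [AddCommGroup E] [Module ℝ E]
    [Fintype κ] {P : Set E} (hP : IsPolyhedron P) (L : E →ₗ[ℝ] κ → ℝ) {z : E} (hz : z ∈ P)
    {s : E →ₗ[ℝ] ℝ} (hs : ∀ w ∈ P, L w = L z → 0 ≤ s (w - z)) :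
    ∃ p : κ → ℝ, ∀ w ∈ P, p ⬝ᵥ L (w - z) ≤ s (w - z) := by
  classical
  obtain ⟨N, a, c, rfl⟩ := hP
  -- Farkas' lemma is applied on the kernel of `L`, where no equality constraint is left.
  obtain ⟨μ, hμ, h⟩ := farkas (Finset.univ.filter fun i => a i z = c i)
    (fun i => a i ∘ₗ (LinearMap.ker L).subtype) (-(s ∘ₗ (LinearMap.ker L).subtype)) (by
      rintro ⟨d, hd⟩ had
      obtain ⟨t, ht, hf⟩ := exists_feasible_step (d := d) hz (by simpa using had)
      have h1 := hs _ hf (by rw [map_add, map_smul, LinearMap.mem_ker.1 hd, smul_zero, add_zero])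
      rw [add_sub_cancel_left, map_smul, smul_eq_mul] at h1
      have h2 := nonneg_of_mul_nonneg_right h1 ht
      simpa using h2)
  have hmem : s + ∑ i ∈ Finset.univ.filter (fun i => a i z = c i), μ i • a i ∈
      LinearMap.range L.dualMap := by
    rw [LinearMap.range_dualMap_eq_dualAnnihilator_ker, Submodule.mem_dualAnnihilator]
    intro d hd
    have := LinearMap.congr_fun h ⟨d, hd⟩
    simp only [LinearMap.neg_apply, LinearMap.comp_apply, Submodule.subtype_apply,
      LinearMap.sum_apply, LinearMap.smul_apply] at this
    simp only [LinearMap.add_apply, LinearMap.sum_apply, LinearMap.smul_apply]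
    rw [← this]
    ring
  obtain ⟨ψ, hψ⟩ := hmem
  refine ⟨(dotProductEquiv ℝ κ).symm ψ, fun w hw => ?_⟩
  have h1 := LinearMap.congr_fun hψ (w - z)
  have h2 : (dotProductEquiv ℝ κ).symm ψ ⬝ᵥ L (w - z) = ψ (L (w - z)) :=
    LinearMap.congr_fun ((dotProductEquiv ℝ κ).apply_symm_apply ψ) _
  simp only [LinearMap.dualMap_apply, LinearMap.add_apply, LinearMap.sum_apply,
    LinearMap.smul_apply, smul_eq_mul] at h1
  rw [h2, h1, add_le_iff_nonpos_right]
  refine Finset.sum_nonpos fun i hi => mul_nonpos_of_nonneg_of_nonpos (hμ i) ?_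
  rw [map_sub, (Finset.mem_filter.1 hi).2]
  exact sub_nonpos.2 (hw i)

/-! ### Minimizers of convex functions -/

/-- A minimizer of a finite convex function over a convex set admits a subgradient whose negative
is normal to the set. -/
theorem IsArgmin.exists_subgradient {E : Type*} [NormedAddCommGroup E] [NormedSpace ℝ E]
    [FiniteDimensional ℝ E] {φ : E → ℝ} (hφ : ConvexOn ℝ Set.univ φ) {C : Set E}
    (hC : Convex ℝ C) {z : E} (hz : IsArgmin φ C z) :
    ∃ s : E →ₗ[ℝ] ℝ, (∀ w, φ z + s (w - z) ≤ φ w) ∧ ∀ w ∈ C, 0 ≤ s (w - z) := by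
  have hcont : Continuous φ := hφ.locallyLipschitz.continuous
  -- The strict epigraph of `φ` is separated from `C × (-∞, φ z]`.
  obtain ⟨F, u, hF1, hF2⟩ := geometric_hahn_banach_open (s := {p : E × ℝ | φ p.1 < p.2})
    (t := C ×ˢ Set.Iic (φ z)) (by simpa using hφ.convex_strict_epigraph)
    (isOpen_lt (hcont.comp continuous_fst) continuous_snd) (hC.prod (convex_Iic _))
    (by
      rw [Set.disjoint_left]
      rintro ⟨w, t⟩ h1 ⟨h2, h3⟩
      exact absurd (hz.2 w h2) (not_le.2 (lt_of_lt_of_le h1 h3)))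
  have hsplit : ∀ w t, F (w, t) = F (w, 0) + F (0, 1) * t := fun w t => by
    have h1 : (w, t) = (w, (0 : ℝ)) + t • ((0 : E), (1 : ℝ)) := by simp
    rw [h1, map_add, map_smul, smul_eq_mul, mul_comm]
  set κ := F (0, 1)
  have hz0 : u ≤ F (z, 0) + κ * φ z := hsplit z (φ z) ▸ hF2 (z, φ z) ⟨hz.1, Set.self_mem_Iic⟩
  have hκ : κ < 0 := by
    have h1 := hF1 (z, φ z + 1) (lt_add_one (φ z))
    rw [hsplit] at h1
    linarith
  have hw : ∀ w, F (w, 0) + κ * φ w ≤ u := fun w => by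
    refine le_of_forall_pos_le_add fun ε hε => ?_
    have h1 := hF1 (w, φ w + ε / (-κ)) (lt_add_of_pos_right _ (div_pos hε (neg_pos.2 hκ)))
    rw [hsplit] at h1
    have h2 : κ * (ε / (-κ)) = -ε := by rw [div_neg, mul_neg, mul_div_cancel₀ _ hκ.ne]
    linarith
  refine ⟨(-κ)⁻¹ • (F.toLinearMap ∘ₗ LinearMap.inl ℝ E ℝ), fun w => ?_, fun w hwC => ?_⟩
  · have h1 := (hw w).trans hz0
    simp only [LinearMap.smul_apply, LinearMap.comp_apply, LinearMap.inl_apply, smul_eq_mul,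
      ContinuousLinearMap.coe_coe]
    have h2 : F (w - z, 0) = F (w, 0) - F (z, 0) := by rw [← map_sub]; simp
    rw [h2, ← le_sub_iff_add_le', inv_mul_le_iff₀ (neg_pos.2 hκ)]
    linarith
  · have h1 := (hw z).trans (hsplit w (φ z) ▸ hF2 (w, φ z) ⟨hwC, Set.self_mem_Iic⟩)
    have h2 : F (w - z, 0) = F (w, 0) - F (z, 0) := by rw [← map_sub]; simp
    refine mul_nonneg (inv_nonneg.2 (neg_pos.2 hκ).le) ?_
    change 0 ≤ F (w - z, 0)
    rw [h2]
    linarith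

variable {n m l : ℕ}

/-- Minimizing `f - ⟨t, ·⟩` over `X` means that `t` lies in `∂f + N_X`. -/
theorem isArgmin_sub_iff {f : (Fin n → ℝ) → ℝ} (hf : ConvexOn ℝ Set.univ f)
    {X : Set (Fin n → ℝ)} (hX : Convex ℝ X) (x t : Fin n → ℝ) :
    IsArgmin (fun z => f z - t ⬝ᵥ z) X x ↔ ∃ ξ ∈ subdiff f x, t - ξ ∈ normalCone X x := by
  constructor
  · intro h
    have hconv : ConvexOn ℝ Set.univ (fun z => f z - t ⬝ᵥ z) :=
      hf.sub ((dotProductEquiv ℝ (Fin n) t).concaveOn convex_univ)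
    obtain ⟨s, hs1, hs2⟩ := h.exists_subgradient hconv hX
    obtain ⟨σ, rfl⟩ := (dotProductEquiv ℝ (Fin n)).surjective s
    simp only [dotProductEquiv_apply_apply] at hs1 hs2
    refine ⟨t + σ, fun z => ?_, h.1, fun w hw => ?_⟩
    · have := hs1 z
      rw [add_dotProduct, dotProduct_sub t]
      linarith
    · have := hs2 w hw
      rw [sub_add_cancel_left, neg_dotProduct]
      linarith
  · rintro ⟨ξ, hξ, hx, hN⟩
    refine ⟨hx, fun w hw => ?_⟩
    have h1 := hξ w
    have h2 := hN w hw
    rw [sub_dotProduct, dotProduct_sub t] at h2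
    linarith

/-- The graph of `x ↦ ∂f(x) + N_X(x)` is a finite union of linear images of polyhedra; the
auxiliary variables are the subgradient and the multipliers of the inequalities defining `X`. -/
theorem exists_polyhedral_lift {f : (Fin n → ℝ) → ℝ} (hf : ConvexOn ℝ Set.univ f)
    (hfpl : IsPiecewiseLinear (subdiff f)) {X : Set (Fin n → ℝ)} (hX : IsPolyhedron X) :
    ∃ (N : ℕ) (ι : Type) (_ : Fintype ι) (V : ((Fin n → ℝ) × (Fin N → ℝ)) →ₗ[ℝ] Fin n → ℝ)
      (Q : ι → Set ((Fin n → ℝ) × ((Fin n → ℝ) × (Fin N → ℝ)))),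
      (∀ i, IsPolyhedron (Q i)) ∧ ∀ x t, IsArgmin (fun z => f z - t ⬝ᵥ z) X x ↔
        ∃ i h, (x, h) ∈ Q i ∧ t = V h := by
  classical
  have hXc := hX.convex
  obtain ⟨K, P, hP, hgraph⟩ := hfpl
  obtain ⟨N, a, c, rfl⟩ := hX
  have ha : ∀ i, ∃ v : Fin n → ℝ, ∀ z, a i z = v ⬝ᵥ z := fun i =>
    ⟨(dotProductEquiv ℝ (Fin n)).symm (a i), fun z =>
      (LinearMap.congr_fun ((dotProductEquiv ℝ (Fin n)).apply_symm_apply (a i)) z).symm⟩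
  choose v hv using ha
  let E := (Fin n → ℝ) × ((Fin n → ℝ) × (Fin N → ℝ))
  let px : E →ₗ[ℝ] Fin n → ℝ := LinearMap.fst ℝ _ _
  let pξ : E →ₗ[ℝ] Fin n → ℝ := LinearMap.fst ℝ _ _ ∘ₗ LinearMap.snd ℝ _ _
  let pμ : Fin N → E →ₗ[ℝ] ℝ := fun i =>
    LinearMap.proj i ∘ₗ LinearMap.snd ℝ _ _ ∘ₗ LinearMap.snd ℝ _ _
  -- `J` is a set of constraints that are required to be active.
  let Q : Fin K × Finset (Fin N) → Set E := fun q =>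
    ((px.prod pξ) ⁻¹' P q.1) ∩ ({e | ∀ i, (a i ∘ₗ px) e ≤ c i} ∩
      ({e | ∀ i, (-pμ i) e ≤ 0} ∩ ({e | ∀ i : {i // i ∈ q.2}, (-(a i ∘ₗ px)) e ≤ -c i} ∩
        {e | ∀ i : {i // i ∉ q.2}, pμ i e ≤ 0})))
  have hQ : ∀ q, IsPolyhedron (Q q) := fun q =>
    ((hP q.1).preimage _).inter ((IsPolyhedron.of_finite _ _).inter
      ((IsPolyhedron.of_finite _ _).inter ((IsPolyhedron.of_finite _ _).inter
        (IsPolyhedron.of_finite _ _))))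
  refine ⟨N, Fin K × Finset (Fin N), inferInstance,
    LinearMap.fst ℝ _ _ + (Fintype.linearCombination ℝ v) ∘ₗ LinearMap.snd ℝ _ _, Q, hQ,
    fun x t => ?_⟩
  rw [isArgmin_sub_iff hf hXc]
  have hpair : ∀ ξ, ξ ∈ subdiff f x ↔ ∃ k, (x, ξ) ∈ P k := fun ξ => by
    have := Set.ext_iff.1 hgraph (x, ξ)
    simpa using this
  constructor
  · rintro ⟨ξ, hξ, hx, hN⟩
    obtain ⟨k, hk⟩ := (hpair ξ).1 hξ
    obtain ⟨μ, hμ0, hμ, hsum⟩ := exists_multipliers (a := a) (c := c) hx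
      (φ := dotProductEquiv ℝ (Fin n) (t - ξ)) hN
    refine ⟨(k, Finset.univ.filter fun i => a i x = c i), (ξ, μ),
      ⟨hk, hx, fun i => ?_, ?_, ?_⟩, ?_⟩
    · exact neg_nonpos.2 (hμ0 i)
    · rintro ⟨i, hi⟩
      exact neg_le_neg (Finset.mem_filter.1 hi).2.ge
    · rintro ⟨i, hi⟩
      exact (hμ i (by simpa using hi)).le
    · have : t - ξ = ∑ i, μ i • v i := by
        apply (dotProductEquiv ℝ (Fin n)).injective
        rw [hsum]
        ext z
        simp [hv]
      simp only [LinearMap.add_apply, LinearMap.fst_apply, LinearMap.comp_apply,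
        LinearMap.snd_apply, Fintype.linearCombination_apply, ← this, add_sub_cancel]
  · rintro ⟨⟨k, J⟩, ⟨ξ, μ⟩, ⟨hk, hx, hμ, hJ, hJ'⟩, rfl⟩
    refine ⟨ξ, (hpair ξ).2 ⟨k, hk⟩, hx, fun w hw => ?_⟩
    simp only [LinearMap.add_apply, LinearMap.fst_apply, LinearMap.comp_apply,
      LinearMap.snd_apply, Fintype.linearCombination_apply, add_sub_cancel_left,
      sum_dotProduct, smul_dotProduct, ← hv, smul_eq_mul]
    refine Finset.sum_nonpos fun i _ => ?_
    by_cases hi : i ∈ J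
    · have h1 : c i ≤ a i x := neg_le_neg_iff.1 (hJ ⟨i, hi⟩)
      have h2 := hw i
      rw [map_sub]
      exact mul_nonpos_of_nonneg_of_nonpos (neg_nonpos.1 (hμ i)) (by linarith)
    · have : μ i = 0 := le_antisymm (hJ' ⟨i, hi⟩) (neg_nonpos.1 (hμ i))
      simp [this]

theorem isClosed_setOf_isArgmin {α : Type*} [TopologicalSpace α] {f : (Fin n → ℝ) → ℝ}
    (hf : Continuous f) {X : Set (Fin n → ℝ)} (hX : IsClosed X) {t x : α → Fin n → ℝ}
    (ht : Continuous t) (hx : Continuous x) :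
    IsClosed {u | IsArgmin (fun z => f z - t u ⬝ᵥ z) X (x u)} := by
  have : {u | IsArgmin (fun z => f z - t u ⬝ᵥ z) X (x u)} =
      x ⁻¹' X ∩ ⋂ w ∈ X, {u | f (x u) - t u ⬝ᵥ x u ≤ f w - t u ⬝ᵥ w} := by
    ext u
    simp [IsArgmin]
  rw [this]
  exact (hX.preimage hx).inter (isClosed_biInter fun w _ => isClosed_le
    ((hf.comp hx).sub (ht.dotProduct hx)) (continuous_const.sub (ht.dotProduct continuous_const)))

/-- First-order optimality: a smooth term of the objective may be replaced by its linearization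
at the minimizer. The term `q` enters only through a quadratic upper bound on it. -/
theorem IsArgmin.linearize {f q : (Fin n → ℝ) → ℝ} (hf : ConvexOn ℝ Set.univ f)
    {X : Set (Fin n → ℝ)} (hX : Convex ℝ X) {x t : Fin n → ℝ}
    (h : IsArgmin (fun z => f z + q z) X x)
    (hq : ∀ d, ∃ K : ℝ, ∀ s : ℝ, q (x + s • d) ≤ q x - s * (t ⬝ᵥ d) + s ^ 2 * K) :
    IsArgmin (fun z => f z - t ⬝ᵥ z) X x := by
  refine ⟨h.1, fun w hw => ?_⟩
  obtain ⟨K, hK⟩ := hq (w - x)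
  have key : ∀ s : ℝ, 0 < s → s ≤ 1 → t ⬝ᵥ (w - x) - (f w - f x) ≤ s * K := fun s hs hs1 => by
    have hmem : x + s • (w - x) ∈ X := hX.add_smul_sub_mem h.1 hw ⟨hs.le, hs1⟩
    have h1 := h.2 _ hmem
    have h2 := hf.2 (Set.mem_univ x) (Set.mem_univ w) (sub_nonneg.2 hs1) hs.le
      (sub_add_cancel 1 s)
    have h3 : (1 - s) • x + s • w = x + s • (w - x) := by module
    rw [h3, smul_eq_mul, smul_eq_mul] at h2
    have h4 := hK s
    dsimp only at h1
    have h5 : s * (t ⬝ᵥ (w - x) - (f w - f x)) ≤ s * (s * K) := by nlinarith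
    exact le_of_mul_le_mul_left h5 hs
  have hlim : t ⬝ᵥ (w - x) - (f w - f x) ≤ 0 := by
    have htend : Filter.Tendsto (fun s : ℝ => s * K) (nhdsWithin 0 (Set.Ioi 0)) (nhds (0 * K)) :=
      ((continuous_id.mul continuous_const).tendsto 0).mono_left nhdsWithin_le_nhds
    rw [zero_mul] at htend
    refine ge_of_tendsto htend ?_
    filter_upwards [Ioc_mem_nhdsGT (zero_lt_one (α := ℝ))] with s hs
    exact key s hs.1 hs.2
  rw [dotProduct_sub] at hlim
  dsimp only
  linarith

/-- Monotonicity of `∂f + N_X`. -/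
theorem IsArgmin.monotone {f : (Fin n → ℝ) → ℝ} {X : Set (Fin n → ℝ)} {x x' t t' : Fin n → ℝ}
    (h : IsArgmin (fun z => f z - t ⬝ᵥ z) X x) (h' : IsArgmin (fun z => f z - t' ⬝ᵥ z) X x') :
    0 ≤ (t - t') ⬝ᵥ (x - x') := by
  have h1 := h.2 x' h'.1
  have h2 := h'.2 x h.1
  simp only [sub_dotProduct, dotProduct_sub] at *
  linarith

/-! ### The set of KKT points -/

section KKT

variable {A : Matrix (Fin l) (Fin n) ℝ} {B : Matrix (Fin l) (Fin m) ℝ} {b : Fin l → ℝ}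
  {X : Set (Fin n → ℝ)} {Y : Set (Fin m → ℝ)} {f : (Fin n → ℝ) → ℝ} {g : (Fin m → ℝ) → ℝ}

theorem stack_mem_KKTSet_iff (hf : ConvexOn ℝ Set.univ f) (hg : ConvexOn ℝ Set.univ g)
    (hX : Convex ℝ X) (hY : Convex ℝ Y) (x : Fin n → ℝ) (y : Fin m → ℝ) (p : Fin l → ℝ) :
    stack x y p ∈ KKTSet A B b X Y f g ↔ IsArgmin (fun z => f z - (Aᵀ *ᵥ p) ⬝ᵥ z) X x ∧
      IsArgmin (fun z => g z - (Bᵀ *ᵥ p) ⬝ᵥ z) Y y ∧ A *ᵥ x + B *ᵥ y - b = 0 := by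
  rw [isArgmin_sub_iff hf hX, isArgmin_sub_iff hg hY]
  constructor
  · rintro ⟨x', y', p', heq, h⟩
    obtain ⟨rfl, h1⟩ := Sum.elim_eq_iff.1 heq
    obtain ⟨rfl, rfl⟩ := Sum.elim_eq_iff.1 h1
    simpa only [neg_sub] using h
  · intro h
    refine ⟨x, y, p, rfl, ?_⟩
    simpa only [neg_sub] using h

theorem exists_stack (u : Fin n ⊕ Fin m ⊕ Fin l → ℝ) : ∃ x y p, u = stack x y p :=
  ⟨fun i => u (.inl i), fun i => u (.inr (.inl i)), fun i => u (.inr (.inr i)), by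
    ext (i | i | i) <;> rfl⟩

theorem isClosed_KKTSet (hf : ConvexOn ℝ Set.univ f) (hg : ConvexOn ℝ Set.univ g)
    (hX : IsPolyhedron X) (hY : IsPolyhedron Y) : IsClosed (KKTSet A B b X Y f g) := by
  let px : (Fin n ⊕ Fin m ⊕ Fin l → ℝ) → Fin n → ℝ := fun u i => u (.inl i)
  let py : (Fin n ⊕ Fin m ⊕ Fin l → ℝ) → Fin m → ℝ := fun u i => u (.inr (.inl i))
  let pl : (Fin n ⊕ Fin m ⊕ Fin l → ℝ) → Fin l → ℝ := fun u i => u (.inr (.inr i))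
  have hpx : Continuous px := by fun_prop
  have hpy : Continuous py := by fun_prop
  have hpl : Continuous pl := by fun_prop
  have heq : KKTSet A B b X Y f g =
      {u | IsArgmin (fun z => f z - (Aᵀ *ᵥ pl u) ⬝ᵥ z) X (px u)} ∩
      ({u | IsArgmin (fun z => g z - (Bᵀ *ᵥ pl u) ⬝ᵥ z) Y (py u)} ∩
        {u | A *ᵥ px u + B *ᵥ py u - b = 0}) := by
    ext u
    obtain ⟨x, y, p, rfl⟩ := exists_stack u
    exact stack_mem_KKTSet_iff hf hg hX.convex hY.convex x y p
  rw [heq]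
  refine (isClosed_setOf_isArgmin hf.locallyLipschitz.continuous hX.isClosed ?_ hpx).inter
    ((isClosed_setOf_isArgmin hg.locallyLipschitz.continuous hY.isClosed ?_ hpy).inter
      (isClosed_eq ?_ continuous_const))
  · exact continuous_const.matrix_mulVec hpl
  · exact continuous_const.matrix_mulVec hpl
  · exact ((continuous_const.matrix_mulVec hpx).add (continuous_const.matrix_mulVec hpy)).sub
      continuous_const

/-- Every optimal solution has a Lagrange multiplier. -/
theorem KKTSet_nonempty (hf : ConvexOn ℝ Set.univ f) (hg : ConvexOn ℝ Set.univ g)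
    (hX : IsPolyhedron X) (hY : IsPolyhedron Y) {x : Fin n → ℝ} {y : Fin m → ℝ}
    (h : IsOptimal A B b X Y f g x y) : (KKTSet A B b X Y f g).Nonempty := by
  let L : ((Fin n → ℝ) × (Fin m → ℝ)) →ₗ[ℝ] Fin l → ℝ := A.mulVecLin.coprod B.mulVecLin
  have hL : ∀ q, L q = A *ᵥ q.1 + B *ᵥ q.2 := fun q => rfl
  obtain ⟨hx, hy, hb⟩ := h.1
  have hP : IsPolyhedron {q : (Fin n → ℝ) × (Fin m → ℝ) | q.1 ∈ X ∧ q.2 ∈ Y} :=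
    (hX.preimage (LinearMap.fst ℝ (Fin n → ℝ) (Fin m → ℝ))).inter
      (hY.preimage (LinearMap.snd ℝ (Fin n → ℝ) (Fin m → ℝ)))
  have hconv : ConvexOn ℝ Set.univ (fun q : (Fin n → ℝ) × (Fin m → ℝ) => f q.1 + g q.2) :=
    (hf.comp_linearMap (LinearMap.fst ℝ (Fin n → ℝ) (Fin m → ℝ))).add
      (hg.comp_linearMap (LinearMap.snd ℝ (Fin n → ℝ) (Fin m → ℝ)))
  have hC : Convex ℝ {q : (Fin n → ℝ) × (Fin m → ℝ) |
      q.1 ∈ X ∧ q.2 ∈ Y ∧ A *ᵥ q.1 + B *ᵥ q.2 = b} := by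
    have h1 : {q : (Fin n → ℝ) × (Fin m → ℝ) | q.1 ∈ X ∧ q.2 ∈ Y ∧ A *ᵥ q.1 + B *ᵥ q.2 = b} =
        {q | q.1 ∈ X ∧ q.2 ∈ Y} ∩ L ⁻¹' {b} := by
      ext q
      simp [hL, and_assoc]
    rw [h1]
    exact hP.convex.inter ((convex_singleton b).linear_preimage L)
  obtain ⟨s, hs1, hs2⟩ := IsArgmin.exists_subgradient hconv hC h
  obtain ⟨p, hp⟩ := hP.exists_equality_multiplier L (z := (x, y)) ⟨hx, hy⟩ (s := s)
    (fun w hw hLw => hs2 w ⟨hw.1, hw.2, hLw.trans hb⟩)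
  refine ⟨stack x y p, (stack_mem_KKTSet_iff hf hg hX.convex hY.convex x y p).2
    ⟨⟨hx, fun w hw => ?_⟩, ⟨hy, fun w hw => ?_⟩, sub_eq_zero.2 hb⟩⟩
  · have h1 := hs1 (w, y)
    have h2 := hp (w, y) ⟨hw, hy⟩
    rw [hL] at h2
    simp only [Prod.mk_sub_mk, sub_self, mulVec_zero, add_zero, mulVec_sub, dotProduct_sub] at h1 h2
    simp only [mulVec_transpose, ← dotProduct_mulVec]
    linarith
  · have h1 := hs1 (x, w)
    have h2 := hp (x, w) ⟨hx, hw⟩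
    rw [hL] at h2
    simp only [Prod.mk_sub_mk, sub_self, mulVec_zero, zero_add, mulVec_sub, dotProduct_sub] at h1 h2
    simp only [mulVec_transpose, ← dotProduct_mulVec]
    linarith

/-- Error bound for the KKT system. The residuals are `t₁ - Aᵀp ∈ ∂f(x) + N_X(x) - Aᵀp`,
`t₂ - Bᵀp ∈ ∂g(y) + N_Y(y) - Bᵀp` and `A x + B y - b`; either they control the distance to the
set of KKT points, or they are bounded below. -/
theorem KKTSet_error_bound (A : Matrix (Fin l) (Fin n) ℝ) (B : Matrix (Fin l) (Fin m) ℝ)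
    (b : Fin l → ℝ) (hf : ConvexOn ℝ Set.univ f) (hg : ConvexOn ℝ Set.univ g)
    (hfpl : IsPiecewiseLinear (subdiff f)) (hgpl : IsPiecewiseLinear (subdiff g))
    (hX : IsPolyhedron X) (hY : IsPolyhedron Y) :
    ∃ C : ℝ, 0 ≤ C ∧ ∀ x y p t₁ t₂, IsArgmin (fun z => f z - t₁ ⬝ᵥ z) X x →
      IsArgmin (fun z => g z - t₂ ⬝ᵥ z) Y y →
      (∃ x' y' p', stack x' y' p' ∈ KKTSet A B b X Y f g ∧ ‖(x - x', y - y', p - p')‖ ≤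
        C * ‖(t₁ - Aᵀ *ᵥ p, t₂ - Bᵀ *ᵥ p, A *ᵥ x + B *ᵥ y - b)‖) ∨
      1 ≤ C * ‖(t₁ - Aᵀ *ᵥ p, t₂ - Bᵀ *ᵥ p, A *ᵥ x + B *ᵥ y - b)‖ := by
  obtain ⟨N, ι, _, V, Q, hQ, hV⟩ := exists_polyhedral_lift hf hfpl hX
  obtain ⟨M, κ, _, W, R, hR, hW⟩ := exists_polyhedral_lift hg hgpl hY
  let E₁ := (Fin n → ℝ) × ((Fin n → ℝ) × (Fin N → ℝ))
  let E₂ := (Fin m → ℝ) × ((Fin m → ℝ) × (Fin M → ℝ))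
  let p₁ : E₁ × E₂ × (Fin l → ℝ) →ₗ[ℝ] E₁ := LinearMap.fst ℝ _ _
  let p₂ : E₁ × E₂ × (Fin l → ℝ) →ₗ[ℝ] E₂ := LinearMap.fst ℝ _ _ ∘ₗ LinearMap.snd ℝ _ _
  let p₃ : E₁ × E₂ × (Fin l → ℝ) →ₗ[ℝ] Fin l → ℝ := LinearMap.snd ℝ _ _ ∘ₗ LinearMap.snd ℝ _ _
  let L : E₁ × E₂ × (Fin l → ℝ) →ₗ[ℝ] (Fin n → ℝ) × (Fin m → ℝ) × (Fin l → ℝ) :=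
    (V ∘ₗ LinearMap.snd ℝ _ _ ∘ₗ p₁ - Aᵀ.mulVecLin ∘ₗ p₃).prod
      ((W ∘ₗ LinearMap.snd ℝ _ _ ∘ₗ p₂ - Bᵀ.mulVecLin ∘ₗ p₃).prod
        (A.mulVecLin ∘ₗ LinearMap.fst ℝ _ _ ∘ₗ p₁ + B.mulVecLin ∘ₗ LinearMap.fst ℝ _ _ ∘ₗ p₂))
  have hL : ∀ e : E₁ × E₂ × (Fin l → ℝ), L e = (V e.1.2 - Aᵀ *ᵥ e.2.2,
      W e.2.1.2 - Bᵀ *ᵥ e.2.2, A *ᵥ e.1.1 + B *ᵥ e.2.1.1) := fun e => rfl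
  have hP : ∀ q : ι × κ, IsPolyhedron (p₁ ⁻¹' Q q.1 ∩ p₂ ⁻¹' R q.2) := fun q =>
    ((hQ q.1).preimage p₁).inter ((hR q.2).preimage p₂)
  choose C hC0 hC using fun q => (hP q).error_bound L (0, 0, b)
  refine ⟨∑ q, C q, Finset.sum_nonneg fun q _ => hC0 q, fun x y p t₁ t₂ hx hy => ?_⟩
  obtain ⟨i, h, hQi, rfl⟩ := (hV x t₁).1 hx
  obtain ⟨j, k, hRj, rfl⟩ := (hW y t₂).1 hy
  have hle : C (i, j) * ‖L ((x, h), (y, k), p) - (0, 0, b)‖ ≤ (∑ q, C q) *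
      ‖(V h - Aᵀ *ᵥ p, W k - Bᵀ *ᵥ p, A *ᵥ x + B *ᵥ y - b)‖ := by
    rw [hL, Prod.mk_sub_mk, Prod.mk_sub_mk, sub_zero, sub_zero]
    exact mul_le_mul_of_nonneg_right
      (Finset.single_le_sum (fun q _ => hC0 q) (Finset.mem_univ (i, j))) (norm_nonneg _)
  rcases hC (i, j) ((x, h), (y, k), p) ⟨hQi, hRj⟩ with
    ⟨⟨⟨x', h'⟩, ⟨y', k'⟩, p'⟩, ⟨hQ', hR'⟩, hL', hdist⟩ | h1
  · refine Or.inl ⟨x', y', p', ?_, le_trans ?_ (hdist.trans hle)⟩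
    · rw [hL, Prod.mk.injEq, Prod.mk.injEq, sub_eq_zero, sub_eq_zero] at hL'
      obtain ⟨e1, e2, e3⟩ := hL'
      refine (stack_mem_KKTSet_iff hf hg hX.convex hY.convex x' y' p').2
        ⟨(hV _ _).2 ⟨i, h', hQ', e1.symm⟩, (hW _ _).2 ⟨j, k', hR', e2.symm⟩, sub_eq_zero.2 e3⟩
    · simp only [Prod.norm_def, Prod.mk_sub_mk]
      exact max_le_max (le_max_left _ _) (max_le_max (le_max_left _ _) le_rfl)
  · exact Or.inr (h1.trans hle)

end KKT

/-! ### Norms attached to matrices -/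

theorem euclNorm_sq {ι : Type*} [Fintype ι] (v : ι → ℝ) : euclNorm v ^ 2 = v ⬝ᵥ v := by
  rw [euclNorm, EuclideanSpace.norm_sq_eq]
  exact Finset.sum_congr rfl fun i _ => by simp [sq]

section MatNorm

variable {ι : Type*} [Fintype ι] {M : Matrix ι ι ℝ}

theorem matNorm_sq {v : ι → ℝ} (h : 0 ≤ v ⬝ᵥ (M *ᵥ v)) : matNorm M v ^ 2 = v ⬝ᵥ (M *ᵥ v) :=
  Real.sq_sqrt h

theorem quadForm_nonneg (hM : ∀ v, v ≠ 0 → 0 < v ⬝ᵥ (M *ᵥ v)) (v : ι → ℝ) :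
    0 ≤ v ⬝ᵥ (M *ᵥ v) := by
  rcases eq_or_ne v 0 with rfl | hv
  · simp
  · exact (hM v hv).le

theorem continuous_quadForm (M : Matrix ι ι ℝ) : Continuous fun v : ι → ℝ => v ⬝ᵥ (M *ᵥ v) :=
  continuous_id.dotProduct (continuous_const.matrix_mulVec continuous_id)

theorem quadForm_eq_norm_sq_mul (M : Matrix ι ι ℝ) (v : ι → ℝ) :
    v ⬝ᵥ (M *ᵥ v) = ‖v‖ ^ 2 * ((‖v‖⁻¹ • v) ⬝ᵥ (M *ᵥ (‖v‖⁻¹ • v))) := by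
  rcases eq_or_ne v 0 with rfl | hv
  · simp
  · have : ‖v‖ ≠ 0 := norm_ne_zero_iff.2 hv
    simp only [mulVec_smul, smul_dotProduct, dotProduct_smul, smul_eq_mul]
    field_simp

theorem exists_lower_bound_quadForm (hM : ∀ v, v ≠ 0 → 0 < v ⬝ᵥ (M *ᵥ v)) :
    ∃ c : ℝ, 0 < c ∧ ∀ v, c * ‖v‖ ^ 2 ≤ v ⬝ᵥ (M *ᵥ v) := by
  obtain ⟨c, hc, h⟩ : ∃ c : ℝ, 0 < c ∧ ∀ v ∈ Metric.sphere (0 : ι → ℝ) 1,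
      c ≤ v ⬝ᵥ (M *ᵥ v) := by
    rcases (Metric.sphere (0 : ι → ℝ) 1).eq_empty_or_nonempty with he | hne
    · exact ⟨1, one_pos, by simp [he]⟩
    · obtain ⟨v₀, hv₀, hmin⟩ := (isCompact_sphere (0 : ι → ℝ) 1).exists_isMinOn hne
        (continuous_quadForm M).continuousOn
      exact ⟨_, hM v₀ (ne_zero_of_mem_unit_sphere ⟨v₀, hv₀⟩), fun v hv => hmin hv⟩
  refine ⟨c, hc, fun v => ?_⟩
  rcases eq_or_ne v 0 with rfl | hv
  · simp
  · rw [quadForm_eq_norm_sq_mul, mul_comm]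
    refine mul_le_mul_of_nonneg_left (h _ ?_) (sq_nonneg _)
    rw [mem_sphere_zero_iff_norm, norm_smul, norm_inv, norm_norm,
      inv_mul_cancel₀ (norm_ne_zero_iff.2 hv)]

theorem exists_upper_bound_quadForm (M : Matrix ι ι ℝ) :
    ∃ K : ℝ, 0 ≤ K ∧ ∀ v, v ⬝ᵥ (M *ᵥ v) ≤ K * ‖v‖ ^ 2 := by
  obtain ⟨K, hK⟩ := (isCompact_sphere (0 : ι → ℝ) 1).bddAbove_image
    (continuous_quadForm M).continuousOn
  refine ⟨max K 0, le_max_right _ _, fun v => ?_⟩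
  rcases eq_or_ne v 0 with rfl | hv
  · simp
  · rw [quadForm_eq_norm_sq_mul, mul_comm]
    refine mul_le_mul_of_nonneg_right ((hK ⟨_, ?_, rfl⟩).trans (le_max_left _ _)) (sq_nonneg _)
    rw [mem_sphere_zero_iff_norm, norm_smul, norm_inv, norm_norm,
      inv_mul_cancel₀ (norm_ne_zero_iff.2 hv)]

theorem matDist_nonneg (M : Matrix ι ι ℝ) (v : ι → ℝ) (S : Set (ι → ℝ)) : 0 ≤ matDist M v S :=
  Real.sInf_nonneg (by rintro _ ⟨w, _, rfl⟩; exact Real.sqrt_nonneg _)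

theorem matDist_le (M : Matrix ι ι ℝ) (v : ι → ℝ) {S : Set (ι → ℝ)} {w : ι → ℝ} (hw : w ∈ S) :
    matDist M v S ≤ matNorm M (v - w) :=
  csInf_le ⟨0, by rintro _ ⟨w, _, rfl⟩; exact Real.sqrt_nonneg _⟩ ⟨w, hw, rfl⟩

/-- In the norm of a positive definite matrix, every point has a nearest point in a nonempty
closed set. -/
theorem exists_matNorm_eq_matDist (hM : ∀ v, v ≠ 0 → 0 < v ⬝ᵥ (M *ᵥ v)) {S : Set (ι → ℝ)}
    (hS : IsClosed S) (hne : S.Nonempty) (v : ι → ℝ) :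
    ∃ w ∈ S, matNorm M (v - w) = matDist M v S := by
  obtain ⟨c, hc, hlow⟩ := exists_lower_bound_quadForm hM
  obtain ⟨w₀, hw₀⟩ := hne
  have hlow' : ∀ w, ‖v - w‖ ≤ matNorm M (v - w) / Real.sqrt c := fun w => by
    rw [le_div_iff₀ (Real.sqrt_pos.2 hc)]
    refine Real.le_sqrt_of_sq_le ?_
    rw [mul_pow, Real.sq_sqrt hc.le, mul_comm]
    exact hlow _
  have hcont : Continuous fun w => matNorm M (v - w) :=
    ((continuous_quadForm M).comp (continuous_const.sub continuous_id)).sqrt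
  have hK : IsCompact (S ∩ Metric.closedBall v (matNorm M (v - w₀) / Real.sqrt c)) :=
    (isCompact_closedBall _ _).inter_left hS
  obtain ⟨w, ⟨hwS, -⟩, hmin⟩ := hK.exists_isMinOn
    ⟨w₀, hw₀, by rw [mem_closedBall_iff_norm']; exact hlow' w₀⟩ hcont.continuousOn
  suffices h : IsLeast ((fun w => matNorm M (v - w)) '' S) (matNorm M (v - w)) from
    ⟨w, hwS, h.csInf_eq.symm⟩
  refine ⟨⟨w, hwS, rfl⟩, ?_⟩
  rintro _ ⟨w', hw', rfl⟩
  change matNorm M (v - w) ≤ matNorm M (v - w')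
  rcases le_total (matNorm M (v - w')) (matNorm M (v - w₀)) with h | h
  · refine isMinOn_iff.1 hmin w' ⟨hw', ?_⟩
    rw [mem_closedBall_iff_norm']
    exact (hlow' w').trans (div_le_div_of_nonneg_right h (Real.sqrt_nonneg c))
  · exact (isMinOn_iff.1 hmin w₀
      ⟨hw₀, by rw [mem_closedBall_iff_norm']; exact hlow' w₀⟩).trans h

end MatNorm

theorem stack_sub_stack (x x' : Fin n → ℝ) (y y' : Fin m → ℝ) (p p' : Fin l → ℝ) :
    stack x y p - stack x' y' p' = stack (x - x') (y - y') (p - p') := by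
  ext (i | i | i) <;> rfl

theorem norm_stack_le (x : Fin n → ℝ) (y : Fin m → ℝ) (p : Fin l → ℝ) :
    ‖stack x y p‖ ≤ ‖(x, y, p)‖ := by
  refine (pi_norm_le_iff_of_nonneg (norm_nonneg _)).2 ?_
  rintro (i | i | i)
  · exact (norm_le_pi_norm x i).trans (le_max_left _ _)
  · exact (norm_le_pi_norm y i).trans ((le_max_left _ _).trans (le_max_right _ _))
  · exact (norm_le_pi_norm p i).trans ((le_max_right _ _).trans (le_max_right _ _))

theorem quadForm_Hmat (B : Matrix (Fin l) (Fin m) ℝ) (α β : ℝ) (G₁ : Matrix (Fin n) (Fin n) ℝ)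
    (G₂ : Matrix (Fin m) (Fin m) ℝ) (x : Fin n → ℝ) (y : Fin m → ℝ) (p : Fin l → ℝ) :
    stack x y p ⬝ᵥ (Hmat B α β G₁ G₂ *ᵥ stack x y p) =
      x ⬝ᵥ (G₁ *ᵥ x) + y ⬝ᵥ (G₂ *ᵥ y) + (β / α * ((B *ᵥ y) ⬝ᵥ (B *ᵥ y)) +
        2 * ((1 - α) / α) * ((B *ᵥ y) ⬝ᵥ p) + 1 / (α * β) * (p ⬝ᵥ p)) := by
  have h1 : y ⬝ᵥ ((Bᵀ * B) *ᵥ y) = (B *ᵥ y) ⬝ᵥ (B *ᵥ y) := by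
    rw [← mulVec_mulVec, mulVec_transpose, dotProduct_comm, ← dotProduct_mulVec]
  have h2 : y ⬝ᵥ (Bᵀ *ᵥ p) = (B *ᵥ y) ⬝ᵥ p := by
    rw [mulVec_transpose, dotProduct_comm, ← dotProduct_mulVec, dotProduct_comm]
  have h3 : p ⬝ᵥ (B *ᵥ y) = (B *ᵥ y) ⬝ᵥ p := dotProduct_comm _ _
  simp only [Hmat, stack, fromBlocks_mulVec, Sum.elim_comp_inl, Sum.elim_comp_inr, zero_mulVec,
    add_zero, zero_add, sumElim_dotProduct_sumElim, add_mulVec, smul_mulVec, one_mulVec,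
    dotProduct_add, dotProduct_smul, smul_eq_mul, h1, h2, h3]
  ring

/-- `H_α` is positive definite: its `(y, λ)` block is bounded below by `(2 - α) / β ‖λ‖²` plus the
quadratic form of `G₂`. -/
theorem quadForm_Hmat_pos (B : Matrix (Fin l) (Fin m) ℝ) {α β : ℝ} (hα : α ∈ Set.Ioo (0 : ℝ) 2)
    (hβ : 0 < β) {G₁ : Matrix (Fin n) (Fin n) ℝ} {G₂ : Matrix (Fin m) (Fin m) ℝ}
    (hG₁ : ∀ v, v ≠ 0 → 0 < v ⬝ᵥ (G₁ *ᵥ v)) (hG₂ : ∀ v, v ≠ 0 → 0 < v ⬝ᵥ (G₂ *ᵥ v))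
    (u : Fin n ⊕ Fin m ⊕ Fin l → ℝ) (hu : u ≠ 0) : 0 < u ⬝ᵥ (Hmat B α β G₁ G₂ *ᵥ u) := by
  obtain ⟨x, y, p, rfl⟩ := exists_stack u
  obtain ⟨hα0, hα2⟩ := hα
  rw [quadForm_Hmat]
  have h1 := quadForm_nonneg hG₁ x
  have h2 := quadForm_nonneg hG₂ y
  have hid : β / α * ((B *ᵥ y) ⬝ᵥ (B *ᵥ y)) + 2 * ((1 - α) / α) * ((B *ᵥ y) ⬝ᵥ p) +
      1 / (α * β) * (p ⬝ᵥ p) = 1 / (α * β) * ((β • (B *ᵥ y) + (1 - α) • p) ⬝ᵥ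
        (β • (B *ᵥ y) + (1 - α) • p)) + (2 - α) / β * (p ⬝ᵥ p) := by
    simp only [dotProduct, Finset.mul_sum, ← Finset.sum_add_distrib]
    refine Finset.sum_congr rfl fun i _ => ?_
    simp only [Pi.add_apply, Pi.smul_apply, smul_eq_mul]
    field_simp
    ring
  have h3 : 0 ≤ 1 / (α * β) * ((β • (B *ᵥ y) + (1 - α) • p) ⬝ᵥ
      (β • (B *ᵥ y) + (1 - α) • p)) :=
    mul_nonneg (by positivity) (Finset.sum_nonneg fun i _ => mul_self_nonneg _)
  have h4 : 0 < (2 - α) / β := div_pos (by linarith) hβ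
  have h5 : 0 ≤ p ⬝ᵥ p := Finset.sum_nonneg fun i _ => mul_self_nonneg _
  rw [hid]
  by_cases hx : x = 0
  · by_cases hy : y = 0
    · have hp : p ≠ 0 := by
        rintro rfl
        refine hu ?_
        ext (i | i | i)
        · exact congr_fun hx i
        · exact congr_fun hy i
        · rfl
      have h6 : 0 < p ⬝ᵥ p := lt_of_le_of_ne h5 fun h => hp (dotProduct_self_eq_zero.1 h.symm)
      have := mul_pos h4 h6
      linarith
    · have := hG₂ y hy
      have := mul_nonneg h4.le h5
      linarith
  · have := hG₁ x hx
    have := mul_nonneg h4.le h5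
    linarith

/-! ### One iteration of the method -/

/-- First-order optimality for a proximal augmented Lagrangian subproblem. -/
theorem IsArgmin.of_prox_step {f : (Fin n → ℝ) → ℝ} (hf : ConvexOn ℝ Set.univ f)
    {X : Set (Fin n → ℝ)} (hX : Convex ℝ X) {M : Matrix (Fin l) (Fin n) ℝ} {r p : Fin l → ℝ}
    {β : ℝ} {G : Matrix (Fin n) (Fin n) ℝ} (hG : G.PosDef) {x x' : Fin n → ℝ}
    (h : IsArgmin (fun z => f z - z ⬝ᵥ (Mᵀ *ᵥ p) + β / 2 * euclNorm (M *ᵥ z + r) ^ 2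
      + 1 / 2 * matNorm G (z - x) ^ 2) X x') :
    IsArgmin (fun z => f z - (Mᵀ *ᵥ (p - β • (M *ᵥ x' + r)) - G *ᵥ (x' - x)) ⬝ᵥ z) X x' := by
  have hpos : ∀ v, 0 ≤ v ⬝ᵥ (G *ᵥ v) := hG.posSemidef.dotProduct_mulVec_nonneg
  have hsymm : ∀ v w, v ⬝ᵥ (G *ᵥ w) = w ⬝ᵥ (G *ᵥ v) := fun v w => by
    have hGt : Gᵀ = G := hG.isHermitian
    rw [dotProduct_mulVec, dotProduct_comm, ← mulVec_transpose, hGt]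
  refine IsArgmin.linearize (q := fun z => -(z ⬝ᵥ (Mᵀ *ᵥ p)) + β / 2 * euclNorm (M *ᵥ z + r) ^ 2
    + 1 / 2 * matNorm G (z - x) ^ 2) hf hX ?_ fun d =>
      ⟨β / 2 * ((M *ᵥ d) ⬝ᵥ (M *ᵥ d)) + 1 / 2 * (d ⬝ᵥ (G *ᵥ d)), fun s => le_of_eq ?_⟩
  · convert h using 2
    ring
  · have hM : ∀ v : Fin l → ℝ, d ⬝ᵥ (Mᵀ *ᵥ v) = v ⬝ᵥ (M *ᵥ d) := fun v => by
      rw [mulVec_transpose, dotProduct_comm, ← dotProduct_mulVec]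
    have h1 : M *ᵥ (x' + s • d) + r = (M *ᵥ x' + r) + s • (M *ᵥ d) := by
      rw [mulVec_add, mulVec_smul]; abel
    have h2 : x' + s • d - x = (x' - x) + s • d := by abel
    have h3 := hsymm (x' - x) d
    simp only [euclNorm_sq, matNorm_sq (hpos _), h1, h2]
    generalize M *ᵥ x' + r = v at *
    generalize x' - x = e at *
    rw [sub_dotProduct, dotProduct_comm (Mᵀ *ᵥ _) d, dotProduct_comm (G *ᵥ e) d, hM]
    simp only [add_dotProduct, dotProduct_add, smul_dotProduct, dotProduct_smul, mulVec_add,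
      mulVec_smul, sub_dotProduct, smul_eq_mul, h3, hM, dotProduct_comm (M *ᵥ d) v]
    ring

/-- The polarization identity behind the contraction, in the space of multipliers: `a`, `e`, `e'`
stand for `A(x' - x*)`, `B(y - y*)`, `B(y' - y*)`, and `p`, `p'` for the multiplier errors. -/
theorem multiplier_identity {α β : ℝ} (hα : α ≠ 0) (hβ : β ≠ 0) {a e e' p p' : Fin l → ℝ}
    (hp : p' = p - β • (α • (a + e) + (e' - e))) :
    (β / α * (e ⬝ᵥ e) + 2 * ((1 - α) / α) * (e ⬝ᵥ p) + 1 / (α * β) * (p ⬝ᵥ p)) =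
      (β / α * (e' ⬝ᵥ e') + 2 * ((1 - α) / α) * (e' ⬝ᵥ p') + 1 / (α * β) * (p' ⬝ᵥ p')) +
      (2 - α) / (α ^ 2 * β) * (((p - p') + β • (e - e')) ⬝ᵥ ((p - p') + β • (e - e'))) +
      2 * ((p - β • (a + e)) ⬝ᵥ a + p' ⬝ᵥ e') := by
  subst hp
  simp only [dotProduct, Finset.mul_sum, ← Finset.sum_add_distrib]
  refine Finset.sum_congr rfl fun i _ => ?_
  simp only [Pi.add_apply, Pi.sub_apply, Pi.smul_apply, smul_eq_mul]
  field_simp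
  ring

/-- Squared size of a step `(dx, dy)` together with `q = dλ + β B dy`. It is the decrease of
the squared `H_α`-distance to every KKT point achieved by the step. -/
def stepSize (α β : ℝ) (G₁ : Matrix (Fin n) (Fin n) ℝ) (G₂ : Matrix (Fin m) (Fin m) ℝ)
    (dx : Fin n → ℝ) (dy : Fin m → ℝ) (q : Fin l → ℝ) : ℝ :=
  dx ⬝ᵥ (G₁ *ᵥ dx) + dy ⬝ᵥ (G₂ *ᵥ dy) + (2 - α) / (α ^ 2 * β) * (q ⬝ᵥ q)

theorem exists_norm_sq_le_stepSize {α β : ℝ} (hα : α ∈ Set.Ioo (0 : ℝ) 2) (hβ : 0 < β)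
    {G₁ : Matrix (Fin n) (Fin n) ℝ} {G₂ : Matrix (Fin m) (Fin m) ℝ}
    (hG₁ : ∀ v, v ≠ 0 → 0 < v ⬝ᵥ (G₁ *ᵥ v)) (hG₂ : ∀ v, v ≠ 0 → 0 < v ⬝ᵥ (G₂ *ᵥ v)) :
    ∃ K : ℝ, 0 ≤ K ∧ ∀ (dx : Fin n → ℝ) (dy : Fin m → ℝ) (q : Fin l → ℝ),
      ‖(dx, dy, q)‖ ^ 2 ≤ K * stepSize α β G₁ G₂ dx dy q := by
  obtain ⟨c₁, hc₁, h₁⟩ := exists_lower_bound_quadForm hG₁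
  obtain ⟨c₂, hc₂, h₂⟩ := exists_lower_bound_quadForm hG₂
  obtain ⟨c₃, hc₃, h₃⟩ := exists_lower_bound_quadForm (M := (1 : Matrix (Fin l) (Fin l) ℝ))
    (fun v hv => by
      rw [one_mulVec]
      exact lt_of_le_of_ne (Finset.sum_nonneg fun i _ => mul_self_nonneg _)
        fun h => hv (dotProduct_self_eq_zero.1 h.symm))
  have hγ : 0 < (2 - α) / (α ^ 2 * β) :=
    div_pos (by linarith [hα.2]) (mul_pos (pow_pos hα.1 2) hβ)
  set γ := (2 - α) / (α ^ 2 * β) with hγd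
  obtain ⟨c, hc, hcc₁, hcc₂, hcc₃⟩ : ∃ c : ℝ, 0 < c ∧ c ≤ c₁ ∧ c ≤ c₂ ∧ c ≤ γ * c₃ :=
    ⟨min c₁ (min c₂ (γ * c₃)), by positivity, min_le_left _ _,
      (min_le_right _ _).trans (min_le_left _ _), (min_le_right _ _).trans (min_le_right _ _)⟩
  refine ⟨c⁻¹, by positivity, fun dx dy q => ?_⟩
  rw [le_inv_mul_iff₀ hc, stepSize, ← hγd]
  have e₁ := (mul_le_mul_of_nonneg_right hcc₁ (sq_nonneg ‖dx‖)).trans (h₁ dx)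
  have e₂ := (mul_le_mul_of_nonneg_right hcc₂ (sq_nonneg ‖dy‖)).trans (h₂ dy)
  have e₃ : c * ‖q‖ ^ 2 ≤ γ * (q ⬝ᵥ q) := by
    have := h₃ q
    rw [one_mulVec] at this
    have h4 := mul_le_mul_of_nonneg_left this hγ.le
    rw [← mul_assoc] at h4
    exact (mul_le_mul_of_nonneg_right hcc₃ (sq_nonneg ‖q‖)).trans h4
  have p₁ := mul_nonneg hc.le (sq_nonneg ‖dx‖)
  have p₂ := mul_nonneg hc.le (sq_nonneg ‖dy‖)
  have p₃ := mul_nonneg hc.le (sq_nonneg ‖q‖)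
  simp only [Prod.norm_def]
  rcases max_choice ‖dx‖ (max ‖dy‖ ‖q‖) with h | h
  · rw [h]; linarith
  · rw [h]
    rcases max_choice ‖dy‖ ‖q‖ with h | h <;> rw [h] <;> linarith

section Iteration

variable {A : Matrix (Fin l) (Fin n) ℝ} {B : Matrix (Fin l) (Fin m) ℝ} {b : Fin l → ℝ}
  {X : Set (Fin n → ℝ)} {Y : Set (Fin m → ℝ)} {f : (Fin n → ℝ) → ℝ} {g : (Fin m → ℝ) → ℝ}
  {α β : ℝ} {G₁ : Matrix (Fin n) (Fin n) ℝ} {G₂ : Matrix (Fin m) (Fin m) ℝ}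
  {x : ℕ → Fin n → ℝ} {y : ℕ → Fin m → ℝ} {lam : ℕ → Fin l → ℝ}

theorem IsDPGADMM.x_optimality (hseq : IsDPGADMM A B b X Y f g α β G₁ G₂ x y lam)
    (hf : ConvexOn ℝ Set.univ f) (hX : Convex ℝ X) (hG₁ : G₁.PosDef) (k : ℕ) :
    IsArgmin (fun z => f z - (Aᵀ *ᵥ (lam k - β • (A *ᵥ x (k + 1) + (B *ᵥ y k - b)))
      - G₁ *ᵥ (x (k + 1) - x k)) ⬝ᵥ z) X (x (k + 1)) := by
  refine IsArgmin.of_prox_step hf hX hG₁ ?_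
  simpa only [add_sub_assoc] using hseq.x_step k

theorem IsDPGADMM.y_optimality (hseq : IsDPGADMM A B b X Y f g α β G₁ G₂ x y lam)
    (hg : ConvexOn ℝ Set.univ g) (hY : Convex ℝ Y) (hG₂ : G₂.PosDef) (k : ℕ) :
    IsArgmin (fun z => g z - (Bᵀ *ᵥ lam (k + 1) - G₂ *ᵥ (y (k + 1) - y k)) ⬝ᵥ z) Y
      (y (k + 1)) := by
  have h : ∀ z, α • (A *ᵥ x (k + 1)) + (1 - α) • (b - B *ᵥ y k) + B *ᵥ z - b =
      B *ᵥ z + (α • (A *ᵥ x (k + 1)) + (1 - α) • (b - B *ᵥ y k) - b) := fun z => by abel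
  have h1 := hseq.y_step k
  have h2 := hseq.lam_step k
  simp only [h] at h1 h2
  rw [h2]
  exact IsArgmin.of_prox_step hg hY hG₂ h1

/-- Every step decreases the squared `H_α`-distance to every KKT point by its `stepSize`. -/
theorem IsDPGADMM.contraction (hseq : IsDPGADMM A B b X Y f g α β G₁ G₂ x y lam)
    (hf : ConvexOn ℝ Set.univ f) (hg : ConvexOn ℝ Set.univ g)
    (hX : Convex ℝ X) (hY : Convex ℝ Y) (hα : α ≠ 0) (hβ : β ≠ 0)
    (hG₁ : G₁.PosDef) (hG₂ : G₂.PosDef) {xs : Fin n → ℝ} {ys : Fin m → ℝ} {ps : Fin l → ℝ}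
    (hs : stack xs ys ps ∈ KKTSet A B b X Y f g) (k : ℕ) :
    (stack (x (k + 1)) (y (k + 1)) (lam (k + 1)) - stack xs ys ps) ⬝ᵥ
        (Hmat B α β G₁ G₂ *ᵥ (stack (x (k + 1)) (y (k + 1)) (lam (k + 1)) - stack xs ys ps)) +
      stepSize α β G₁ G₂ (x k - x (k + 1)) (y k - y (k + 1))
        ((lam k - lam (k + 1)) + β • (B *ᵥ (y k - y (k + 1)))) ≤
    (stack (x k) (y k) (lam k) - stack xs ys ps) ⬝ᵥ
        (Hmat B α β G₁ G₂ *ᵥ (stack (x k) (y k) (lam k) - stack xs ys ps)) := by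
  obtain ⟨hxs, hys, hbs⟩ := (stack_mem_KKTSet_iff hf hg hX hY xs ys ps).1 hs
  have hmx := (hseq.x_optimality hf hX hG₁ k).monotone hxs
  have hmy := (hseq.y_optimality hg hY hG₂ k).monotone hys
  have hb : b = A *ᵥ xs + B *ᵥ ys := (sub_eq_zero.1 hbs).symm
  -- Polarization of the proximal terms.
  have hG : ∀ {N : ℕ} {G : Matrix (Fin N) (Fin N) ℝ}, G.PosDef → ∀ u u' s : Fin N → ℝ,
      (u - s) ⬝ᵥ (G *ᵥ (u - s)) = (u' - s) ⬝ᵥ (G *ᵥ (u' - s)) +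
        (u - u') ⬝ᵥ (G *ᵥ (u - u')) - 2 * ((G *ᵥ (u' - u)) ⬝ᵥ (u' - s)) := by
    intro N G hGp u u' s
    have hsymm : ∀ v w, v ⬝ᵥ (G *ᵥ w) = w ⬝ᵥ (G *ᵥ v) := fun v w => by
      have hGt : Gᵀ = G := hGp.isHermitian
      rw [dotProduct_mulVec, dotProduct_comm, ← mulVec_transpose, hGt]
    have h1 : u - s = (u' - s) + (u - u') := by abel
    have h2 : u' - u = -(u - u') := by abel
    rw [h1, h2]
    generalize u' - s = v
    generalize u - u' = w
    rw [mulVec_neg, neg_dotProduct, dotProduct_comm (G *ᵥ w) v, mulVec_add, add_dotProduct,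
      dotProduct_add, dotProduct_add, hsymm w v]
    ring
  have hG₁' := hG hG₁ (x k) (x (k + 1)) xs
  have hG₂' := hG hG₂ (y k) (y (k + 1)) ys
  have hp : lam (k + 1) - ps = (lam k - ps) - β • (α • (A *ᵥ (x (k + 1) - xs) +
      B *ᵥ (y k - ys)) + (B *ᵥ (y (k + 1) - ys) - B *ᵥ (y k - ys))) := by
    rw [hseq.lam_step k, hb]
    simp only [mulVec_sub]
    module
  have hid := multiplier_identity hα hβ hp
  have e1 : lam k - ps - (lam (k + 1) - ps) = lam k - lam (k + 1) := by abel
  have e2 : B *ᵥ (y k - ys) - B *ᵥ (y (k + 1) - ys) = B *ᵥ (y k - y (k + 1)) := by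
    rw [← mulVec_sub]; congr 1; abel
  rw [e1, e2] at hid
  have hx' : (Aᵀ *ᵥ (lam k - β • (A *ᵥ x (k + 1) + (B *ᵥ y k - b)))
      - G₁ *ᵥ (x (k + 1) - x k) - Aᵀ *ᵥ ps) ⬝ᵥ (x (k + 1) - xs) =
      (lam k - ps - β • (A *ᵥ (x (k + 1) - xs) + B *ᵥ (y k - ys))) ⬝ᵥ
        (A *ᵥ (x (k + 1) - xs)) - (G₁ *ᵥ (x (k + 1) - x k)) ⬝ᵥ (x (k + 1) - xs) := by
    rw [sub_right_comm, ← mulVec_sub, sub_dotProduct, mulVec_transpose, ← dotProduct_mulVec]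
    congr 2
    rw [hb]
    simp only [mulVec_sub]
    module
  have hy' : (Bᵀ *ᵥ lam (k + 1) - G₂ *ᵥ (y (k + 1) - y k) - Bᵀ *ᵥ ps) ⬝ᵥ (y (k + 1) - ys) =
      (lam (k + 1) - ps) ⬝ᵥ (B *ᵥ (y (k + 1) - ys)) -
        (G₂ *ᵥ (y (k + 1) - y k)) ⬝ᵥ (y (k + 1) - ys) := by
    rw [sub_right_comm, ← mulVec_sub, sub_dotProduct, mulVec_transpose, ← dotProduct_mulVec]
  rw [hx'] at hmx
  rw [hy'] at hmy
  rw [stack_sub_stack, stack_sub_stack, quadForm_Hmat, quadForm_Hmat, stepSize]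
  linarith

/-- The KKT residual at the new iterate is controlled by the step. -/
theorem exists_residual_bound (A : Matrix (Fin l) (Fin n) ℝ)
    (B : Matrix (Fin l) (Fin m) ℝ) (α β : ℝ) (hα : α ≠ 0) (hβ : β ≠ 0)
    (G₁ : Matrix (Fin n) (Fin n) ℝ) (G₂ : Matrix (Fin m) (Fin m) ℝ) :
    ∃ K : ℝ, 0 ≤ K ∧ ∀ b X Y f g x y lam, IsDPGADMM A B b X Y f g α β G₁ G₂ x y lam → ∀ k : ℕ,
      ‖(Aᵀ *ᵥ (lam k - β • (A *ᵥ x (k + 1) + (B *ᵥ y k - b))) - G₁ *ᵥ (x (k + 1) - x k)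
          - Aᵀ *ᵥ lam (k + 1),
        Bᵀ *ᵥ lam (k + 1) - G₂ *ᵥ (y (k + 1) - y k) - Bᵀ *ᵥ lam (k + 1),
        A *ᵥ x (k + 1) + B *ᵥ y (k + 1) - b)‖ ≤
      K * ‖(x k - x (k + 1), y k - y (k + 1),
        (lam k - lam (k + 1)) + β • (B *ᵥ (y k - y (k + 1))))‖ := by
  let p₁ : (Fin n → ℝ) × (Fin m → ℝ) × (Fin l → ℝ) →ₗ[ℝ] Fin n → ℝ := LinearMap.fst ℝ _ _
  let p₂ : (Fin n → ℝ) × (Fin m → ℝ) × (Fin l → ℝ) →ₗ[ℝ] Fin m → ℝ :=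
    LinearMap.fst ℝ _ _ ∘ₗ LinearMap.snd ℝ _ _
  let p₃ : (Fin n → ℝ) × (Fin m → ℝ) × (Fin l → ℝ) →ₗ[ℝ] Fin l → ℝ :=
    LinearMap.snd ℝ _ _ ∘ₗ LinearMap.snd ℝ _ _
  let D : (Fin n → ℝ) × (Fin m → ℝ) × (Fin l → ℝ) →ₗ[ℝ]
      (Fin n → ℝ) × (Fin m → ℝ) × (Fin l → ℝ) :=
    (Aᵀ.mulVecLin ∘ₗ ((1 - α⁻¹) • p₃ - β • (B.mulVecLin ∘ₗ p₂)) + G₁.mulVecLin ∘ₗ p₁).prod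
      ((G₂.mulVecLin ∘ₗ p₂).prod ((α * β)⁻¹ • p₃ - B.mulVecLin ∘ₗ p₂))
  have hD : ∀ dx dy q, D (dx, dy, q) = (Aᵀ *ᵥ ((1 - α⁻¹) • q - β • (B *ᵥ dy)) + G₁ *ᵥ dx,
      G₂ *ᵥ dy, (α * β)⁻¹ • q - B *ᵥ dy) := fun dx dy q => rfl
  refine ⟨‖D.toContinuousLinearMap‖, norm_nonneg _, fun b X Y f g x y lam hseq k => ?_⟩
  refine le_of_eq_of_le ?_ (D.toContinuousLinearMap.le_opNorm _)
  rw [LinearMap.coe_toContinuousLinearMap', hD]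
  -- The update of the multiplier expresses the mixed constraint residual through the step.
  have hq : lam k - lam (k + 1) + β • (B *ᵥ (y k - y (k + 1))) =
      (α * β) • (A *ᵥ x (k + 1) + (B *ᵥ y k - b)) := by
    rw [hseq.lam_step k]
    simp only [mulVec_sub]
    module
  have hr : (α * β)⁻¹ • (lam k - lam (k + 1) + β • (B *ᵥ (y k - y (k + 1)))) =
      A *ᵥ x (k + 1) + (B *ᵥ y k - b) := by
    rw [hq, smul_smul, inv_mul_cancel₀ (mul_ne_zero hα hβ), one_smul]
  congr 1
  refine Prod.ext ?_ (Prod.ext ?_ ?_)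
  · dsimp only
    have h1 : (1 - α⁻¹) • (lam k - lam (k + 1) + β • (B *ᵥ (y k - y (k + 1)))) -
        β • (B *ᵥ (y k - y (k + 1))) =
        lam k - β • (A *ᵥ x (k + 1) + (B *ᵥ y k - b)) - lam (k + 1) := by
      rw [sub_smul, one_smul]
      nth_rw 2 [hq]
      rw [smul_smul, inv_mul_cancel_left₀ hα]
      abel
    have h2 : x (k + 1) - x k = -(x k - x (k + 1)) := by abel
    rw [h1, h2, mulVec_neg, mulVec_sub Aᵀ _ (lam (k + 1))]
    abel
  · dsimp only
    have h2 : y (k + 1) - y k = -(y k - y (k + 1)) := by abel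
    rw [h2, mulVec_neg]
    abel
  · dsimp only
    rw [hr, mulVec_sub]
    abel

end Iteration

end DPGADMM

end

/-! ### Linear convergence -/

theorem theorem4p1 {n m l : ℕ}
    (A : Matrix (Fin l) (Fin n) ℝ) (B : Matrix (Fin l) (Fin m) ℝ) (b : Fin l → ℝ)
    (X : Set (Fin n → ℝ)) (Y : Set (Fin m → ℝ))
    (hX : DPGADMM.IsPolyhedron X) (hY : DPGADMM.IsPolyhedron Y)
    (f : (Fin n → ℝ) → ℝ) (g : (Fin m → ℝ) → ℝ)
    (hf : ConvexOn ℝ Set.univ f) (hg : ConvexOn ℝ Set.univ g)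
    (hfpl : DPGADMM.IsPiecewiseLinear (DPGADMM.subdiff f))
    (hgpl : DPGADMM.IsPiecewiseLinear (DPGADMM.subdiff g))
    (hsol : ∃ x y, DPGADMM.IsOptimal A B b X Y f g x y)
    (α β : ℝ) (hα : α ∈ Set.Ioo (0 : ℝ) 2) (hβ : 0 < β)
    (G₁ : Matrix (Fin n) (Fin n) ℝ) (G₂ : Matrix (Fin m) (Fin m) ℝ)
    (hG₁ : G₁.PosDef) (hG₂ : G₂.PosDef)
    (x : ℕ → Fin n → ℝ) (y : ℕ → Fin m → ℝ) (lam : ℕ → Fin l → ℝ)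
    (hseq : DPGADMM.IsDPGADMM A B b X Y f g α β G₁ G₂ x y lam) :
    -- the minimum that defines the distance to the set of KKT points is attained
    (∀ v, ∃ w ∈ DPGADMM.KKTSet A B b X Y f g,
      DPGADMM.matNorm (DPGADMM.Hmat B α β G₁ G₂) (v - w) =
        DPGADMM.matDist (DPGADMM.Hmat B α β G₁ G₂) v (DPGADMM.KKTSet A B b X Y f g)) ∧
    ∃ τ : ℝ, 0 < τ ∧ τ < 1 ∧ ∀ k : ℕ,
      DPGADMM.matDist (DPGADMM.Hmat B α β G₁ G₂)
          (DPGADMM.stack (x (k + 1)) (y (k + 1)) (lam (k + 1)))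
          (DPGADMM.KKTSet A B b X Y f g) ^ 2 ≤
        τ * DPGADMM.matDist (DPGADMM.Hmat B α β G₁ G₂)
          (DPGADMM.stack (x k) (y k) (lam k))
          (DPGADMM.KKTSet A B b X Y f g) ^ 2 := by
  open DPGADMM in
  obtain ⟨x₀, y₀, hopt⟩ := hsol
  have hpd₁ : ∀ v, v ≠ 0 → 0 < v ⬝ᵥ (G₁ *ᵥ v) := fun v hv => hG₁.dotProduct_mulVec_pos hv
  have hpd₂ : ∀ v, v ≠ 0 → 0 < v ⬝ᵥ (G₂ *ᵥ v) := fun v hv => hG₂.dotProduct_mulVec_pos hv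
  have hH : ∀ v, v ≠ 0 → 0 < v ⬝ᵥ (Hmat B α β G₁ G₂ *ᵥ v) :=
    quadForm_Hmat_pos B hα hβ hpd₁ hpd₂
  have hatt := exists_matNorm_eq_matDist hH (isClosed_KKTSet (A := A) (B := B) (b := b) hf hg hX hY)
    (KKTSet_nonempty hf hg hX hY hopt)
  refine ⟨hatt, ?_⟩
  have hα0 : α ≠ 0 := hα.1.ne'
  obtain ⟨C, hC0, hC⟩ := KKTSet_error_bound A B b hf hg hfpl hgpl hX hY
  obtain ⟨R, hR0, hR⟩ := exists_residual_bound A B α β hα0 hβ.ne' G₁ G₂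
  obtain ⟨K, hK0, hK⟩ := exists_norm_sq_le_stepSize (l := l) hα hβ hpd₁ hpd₂
  obtain ⟨U, hU0, hU⟩ := exists_upper_bound_quadForm (Hmat B α β G₁ G₂)
  set d : ℕ → ℝ := fun k => matDist (Hmat B α β G₁ G₂) (stack (x k) (y k) (lam k))
    (KKTSet A B b X Y f g)
  set Δ : ℕ → ℝ := fun k => stepSize α β G₁ G₂ (x k - x (k + 1)) (y k - y (k + 1))
    ((lam k - lam (k + 1)) + β • (B *ᵥ (y k - y (k + 1))))
  have hd0 : ∀ k, 0 ≤ d k := fun k => matDist_nonneg _ _ _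
  have hdle : ∀ k {w}, w ∈ KKTSet A B b X Y f g → d k ^ 2 ≤
      (stack (x k) (y k) (lam k) - w) ⬝ᵥ (Hmat B α β G₁ G₂ *ᵥ
        (stack (x k) (y k) (lam k) - w)) := fun k w hw => by
    rw [← matNorm_sq (quadForm_nonneg hH _)]
    exact pow_le_pow_left₀ (hd0 k) (matDist_le _ _ hw) 2
  have hΔ0 : ∀ k, 0 ≤ Δ k := fun k => add_nonneg
    (add_nonneg (quadForm_nonneg hpd₁ _) (quadForm_nonneg hpd₂ _))
    (mul_nonneg (div_nonneg (by linarith [hα.2]) (mul_nonneg (sq_nonneg _) hβ.le))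
      (Finset.sum_nonneg fun i _ => mul_self_nonneg _))
  have hdec : ∀ k, d (k + 1) ^ 2 + Δ k ≤ d k ^ 2 := fun k => by
    obtain ⟨w, hw, hwd⟩ := hatt (stack (x k) (y k) (lam k))
    obtain ⟨xs, ys, ps, rfl⟩ := exists_stack w
    have h1 := hseq.contraction hf hg hX.convex hY.convex hα0 hβ.ne' hG₁ hG₂ hw k
    have h2 := hdle (k + 1) hw
    change d (k + 1) ^ 2 + Δ k ≤ matDist _ _ _ ^ 2
    rw [← hwd, matNorm_sq (quadForm_nonneg hH _)]
    linarith
  have hanti : ∀ k, d k ^ 2 ≤ d 0 ^ 2 := fun k => by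
    induction k with
    | zero => exact le_rfl
    | succ k ih => linarith [hdec k, hΔ0 k]
  have herr : ∀ k, d (k + 1) ^ 2 ≤ ((U + d 0 ^ 2) * C ^ 2 * R ^ 2 * K) * Δ k := fun k => by
    have h1 := hC _ _ (lam (k + 1)) _ _ (hseq.x_optimality hf hX.convex hG₁ k)
      (hseq.y_optimality hg hY.convex hG₂ k)
    have h2 := hR b X Y f g x y lam hseq k
    have h3 := hK (x k - x (k + 1)) (y k - y (k + 1))
      ((lam k - lam (k + 1)) + β • (B *ᵥ (y k - y (k + 1))))
    set ρ := ‖(Aᵀ *ᵥ (lam k - β • (A *ᵥ x (k + 1) + (B *ᵥ y k - b))) -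
      G₁ *ᵥ (x (k + 1) - x k) - Aᵀ *ᵥ lam (k + 1),
      Bᵀ *ᵥ lam (k + 1) - G₂ *ᵥ (y (k + 1) - y k) - Bᵀ *ᵥ lam (k + 1),
      A *ᵥ x (k + 1) + B *ᵥ y (k + 1) - b)‖
    have hρ0 : 0 ≤ ρ := norm_nonneg _
    set σ := ‖(x k - x (k + 1), y k - y (k + 1),
      (lam k - lam (k + 1)) + β • (B *ᵥ (y k - y (k + 1))))‖
    have hres : (C * ρ) ^ 2 ≤ C ^ 2 * R ^ 2 * K * Δ k :=
      calc (C * ρ) ^ 2 = C ^ 2 * ρ ^ 2 := by ring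
        _ ≤ C ^ 2 * (R * σ) ^ 2 := by gcongr
        _ = C ^ 2 * R ^ 2 * σ ^ 2 := by ring
        _ ≤ C ^ 2 * R ^ 2 * (K * Δ k) := by gcongr
        _ = C ^ 2 * R ^ 2 * K * Δ k := by ring
    have hdist : d (k + 1) ^ 2 ≤ (U + d 0 ^ 2) * (C * ρ) ^ 2 := by
      rcases h1 with ⟨xs, ys, ps, hw, hle⟩ | h1
      · have h4 := (hdle (k + 1) hw).trans (hU _)
        rw [stack_sub_stack] at h4
        have h5 := pow_le_pow_left₀ (norm_nonneg _) ((norm_stack_le _ _ _).trans hle) 2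
        have h6 := mul_le_mul_of_nonneg_left h5 hU0
        have h7 := mul_nonneg (sq_nonneg (d 0)) (sq_nonneg (C * ρ))
        linarith
      · -- Far from the solution set, the distance is bounded by its initial value.
        have h4 := hanti (k + 1)
        have h5 := mul_le_mul_of_nonneg_left (one_le_pow₀ h1 (n := 2)) (sq_nonneg (d 0))
        have h6 := mul_nonneg hU0 (sq_nonneg (C * ρ))
        linarith
    calc d (k + 1) ^ 2 ≤ (U + d 0 ^ 2) * (C * ρ) ^ 2 := hdist
      _ ≤ (U + d 0 ^ 2) * (C ^ 2 * R ^ 2 * K * Δ k) :=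
        mul_le_mul_of_nonneg_left hres (add_nonneg hU0 (sq_nonneg _))
      _ = _ := by ring
  obtain ⟨M, hM, hdM⟩ : ∃ M : ℝ, 0 < M ∧ ∀ k, d (k + 1) ^ 2 ≤ M * Δ k :=
    ⟨(U + d 0 ^ 2) * C ^ 2 * R ^ 2 * K + 1, by positivity, fun k => by
      linarith [herr k, hΔ0 k]⟩
  -- `d (k + 1) ^ 2 ≤ M * Δ k ≤ M * (d k ^ 2 - d (k + 1) ^ 2)`
  refine ⟨M / (1 + M), by positivity, (div_lt_one (by positivity)).2 (by linarith), fun k => ?_⟩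
  have h1 := mul_le_mul_of_nonneg_left (hdec k) hM.le
  have h2 := hdM k
  change d (k + 1) ^ 2 ≤ M / (1 + M) * d k ^ 2
  rw [div_mul_eq_mul_div, le_div_iff₀ (by positivity)]
  linarith
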